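/- A generalized partition of an integer $n\ge 1$ is a finite multiset $\{(v_1,w_1),\dots,(v_k,w_k)\}$ of pairs of positive integers with $\sum_{i=1}^k v_iw_i=n$. Let $p_n$ be the number of generalized partitions of $n$, and let $q_n$ be the number of those with $\gcd(v_1,\dots,v_k)=1$. Let $d(\ell)$ denote the number of positive divisors of $\ell$, and for integers $m\ge -1$ and real $\omega>0$ let $$S_m(\omega)=\sum_{k\ge 1}\sum_{\ell\mid k}\ell\, d(\ell)\,k^m e^{-k/\omega}.$$ These series converge absolutely, and for every $n\ge 1$ the equation $S_0(\omega)=n$ has a unique solution $\omega=\omega(n)\in(0,\infty)$. As $n\to\infty$, $q_n\sim p_n$ and $$q_n\sim\frac{1}{\sqrt{2\pi S_1(\omega)}}\exp\left(S_{-1}(\omega)+\frac{n}{\omega}\right),\qquad \omega=\omega(n),$$ where $a_n\sim b_n$ means $\lim_{n\to\infty}a_n/b_n=1$. -/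

import Mathlib

namespace QuasiIdempotent

/-- Generalized partitions `v₁^{w₁} ⋯ v_k^{w_k}` of `n`: finite multisets of pairs `(v, w)` of
positive integers with `∑ vᵢ wᵢ = n`. (A multiset is a word `v^w` up to reordering its letters.) -/
def genPartitions (n : ℕ) : Set (Multiset (ℕ × ℕ)) :=
  {s | (∀ x ∈ s, 0 < x.1 ∧ 0 < x.2) ∧ (s.map fun x => x.1 * x.2).sum = n}

/-- Generalized partitions of `n` with `gcd (v₁, …, v_k) = 1`. -/
def primGenPartitions (n : ℕ) : Set (Multiset (ℕ × ℕ)) :=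
  {s | s ∈ genPartitions n ∧ (s.map Prod.fst).gcd = 1}

/-- There are finitely many generalized partitions of `n`, so the cardinalities below are genuine. -/
theorem genPartitions_finite (n : ℕ) : (genPartitions n).Finite := by
  classical
  let T : Finset (ℕ × ℕ) := Finset.range (n + 1) ×ˢ Finset.range (n + 1)
  refine (Set.finite_Iic (n • T.val)).subset ?_
  rintro s ⟨hpos, hsum⟩
  have hcard : s.card ≤ n := by
    have h : ∀ t : Multiset (ℕ × ℕ), (∀ x ∈ t, 0 < x.1 ∧ 0 < x.2) →
        t.card ≤ (t.map fun x => x.1 * x.2).sum := by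
      intro t
      induction t using Multiset.induction_on with
      | empty => simp
      | cons a t ih =>
        intro ht
        have h1 := ih fun x hx => ht x (Multiset.mem_cons_of_mem hx)
        have h2 := ht a (Multiset.mem_cons_self a t)
        have h3 := Nat.mul_pos h2.1 h2.2
        simp only [Multiset.card_cons, Multiset.map_cons, Multiset.sum_cons]
        omega
    exact hsum ▸ h s hpos
  rw [Set.mem_Iic, Multiset.le_iff_count]
  intro a
  by_cases ha : a ∈ s
  · have hle : a.1 * a.2 ≤ n := by
      rw [← hsum]
      exact Multiset.le_sum_of_mem (Multiset.mem_map_of_mem (fun x : ℕ × ℕ => x.1 * x.2) ha)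
    have h1 : a.1 ≤ n := (Nat.le_mul_of_pos_right _ (hpos a ha).2).trans hle
    have h2 : a.2 ≤ n := (Nat.le_mul_of_pos_left _ (hpos a ha).1).trans hle
    have hT : a ∈ T := by
      simp only [T, Finset.mem_product, Finset.mem_range]
      omega
    rw [Multiset.count_nsmul, Multiset.count_eq_one_of_mem T.nodup hT, mul_one]
    exact (Multiset.count_le_card a s).trans hcard
  · rw [Multiset.count_eq_zero_of_notMem ha]
    exact Nat.zero_le _

/-- `p_n`, the number of generalized partitions of `n`. -/
noncomputable def p (n : ℕ) : ℕ := (genPartitions n).ncard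

/-- `q_n`, the number of generalized partitions of `n` with greatest common divisor `1`. -/
noncomputable def q (n : ℕ) : ℕ := (primGenPartitions n).ncard

/-- The `k`-th term `∑_{ℓ ∣ k} ℓ d(ℓ) k^m e^{-k/ω}` of the series `S_m(ω)`, where `d(ℓ)` is the
number of divisors of `ℓ`. It vanishes for `k = 0`, since `Nat.divisors 0 = ∅`. -/
noncomputable def STerm (m : ℤ) (ω : ℝ) (k : ℕ) : ℝ :=
  ∑ l ∈ k.divisors, (l : ℝ) * (l.divisors.card : ℝ) * (k : ℝ) ^ m * Real.exp (-(k : ℝ) / ω)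

/-- `S_m(ω) = ∑_{k ≥ 1} ∑_{ℓ ∣ k} ℓ d(ℓ) k^m e^{-k/ω}`. -/
noncomputable def S (m : ℤ) (ω : ℝ) : ℝ := ∑' k : ℕ, STerm m ω k

end QuasiIdempotent

/-!
The generating function of `p` is `exp (∑ c k z ^ k)` with `c k = k⁻¹ ∑_{ℓ ∣ k} ℓ d(ℓ)`: this is
the recurrence `n p_n = ∑ (∑_{ℓ ∣ k} ℓ d(ℓ)) p_{n-k}`, obtained by counting the parts of all
generalized partitions of `n` with their weights. The coefficient `p_n` is then a Cauchy integral
over the circle of radius `e ^ (-1 / ω)`, and the choice `S_0(ω) = n` makes the linear term of the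
exponent vanish.

On the arc `|θ| ≲ S_1 / S_2` the exponent is `-S_1 θ² / 2` up to a cubic error, and its real part
is at most `-S_1 θ² / 4`. Outside that arc `1 ≤ c k` allows comparison with the geometric series
`∑ r ^ k (cos kθ - 1)`, where `r = e ^ (-1 / ω)`. This bounds the real part by `-κ ω ^ (3 - 2σ)`
for any `σ > 1`, and for `σ < 3 / 2` the integrand is then smaller than every power of `ω`.
Dominated convergence after the substitution `θ = u / √S_1` yields the Gaussian integral.

Dividing all first entries by their greatest common divisor `d` shows
`p_n - q_n ≤ ∑_{d ≥ 2} p_{n/d}`, and the bound `p_m ≤ exp (S_{-1}(ω) + m / ω)` at the same `ω`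
makes this sum negligible.
-/

namespace QuasiIdempotent

open Filter Topology
open Finset.HasAntidiagonal (antidiagonal mem_antidiagonal)
open scoped Real

/-! ### Weighted multisets -/

/-- The multisets of total weight `n` in a set whose element `x` has weight `v x`. Elements of
weight zero are excluded, so that under mild conditions on `v` there are finitely many of them. -/
def weightedMultisets {α : Type*} (v : α → ℕ) (n : ℕ) : Set (Multiset α) :=
  {s | (∀ x ∈ s, 0 < v x) ∧ (s.map v).sum = n}

section WeightedMultisets

variable {α : Type*} {v : α → ℕ} {n : ℕ} {x : α} {s : Multiset α}

theorem weightedMultisets_zero (v : α → ℕ) : weightedMultisets v 0 = {0} := by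
  ext s
  simp only [weightedMultisets, Set.mem_ofPred_eq, Multiset.sum_eq_zero_iff, Multiset.mem_map,
    Set.mem_singleton_iff]
  constructor
  · rintro ⟨hpos, hzero⟩
    exact Multiset.eq_zero_of_forall_notMem fun x hx => (hpos x hx).ne' (hzero _ ⟨x, hx, rfl⟩)
  · rintro rfl
    simp

theorem apply_le_of_mem_weightedMultisets (hs : s ∈ weightedMultisets v n) (hx : x ∈ s) :
    v x ≤ n :=
  (Multiset.le_sum_of_mem (Multiset.mem_map_of_mem v hx)).trans_eq hs.2

theorem finite_fibre_of_finite_weightedMultisets (hfin : ∀ n, (weightedMultisets v n).Finite)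
    {l : ℕ} (hl : l ≠ 0) : (v ⁻¹' {l}).Finite := by
  have hinj : Function.Injective fun x : α => ({x} : Multiset α) :=
    fun _ _ => Multiset.singleton_inj.1
  refine ((hfin l).preimage hinj.injOn).subset ?_
  rintro x rfl
  simpa [weightedMultisets] using Nat.pos_of_ne_zero hl

theorem image_add_replicate_weightedMultisets [DecidableEq α] (hx : 0 < v x) (m j : ℕ) :
    (· + Multiset.replicate j x) '' weightedMultisets v m =
      {s ∈ weightedMultisets v (j * v x + m) | j ≤ s.count x} := by
  ext s
  constructor
  · rintro ⟨t, ⟨hpos, rfl⟩, rfl⟩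
    refine ⟨⟨fun y hy => ?_, by simp [add_comm]⟩, by simp⟩
    rcases Multiset.mem_add.1 hy with hy | hy
    · exact hpos y hy
    · rwa [Multiset.eq_of_mem_replicate hy]
  · rintro ⟨⟨hpos, hsum⟩, hj⟩
    obtain ⟨t, rfl⟩ := Multiset.le_iff_exists_add.1 (Multiset.le_count_iff_replicate_le.1 hj)
    refine ⟨t, ⟨fun y hy => hpos y (Multiset.mem_add.2 (.inr hy)), ?_⟩, add_comm _ _⟩
    simpa using hsum

theorem card_filter_le_count [DecidableEq α] (hfin : ∀ n, (weightedMultisets v n).Finite)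
    (hx : 0 < v x) (m j : ℕ) :
    {s ∈ (hfin (j * v x + m)).toFinset | j ≤ s.count x}.card = (weightedMultisets v m).ncard := by
  rw [← Set.ncard_image_of_injective _ (add_left_injective (Multiset.replicate j x)),
    image_add_replicate_weightedMultisets hx, ← Set.ncard_coe_finset]
  simp

theorem sum_count_mul_eq [DecidableEq α] (s : Multiset α) :
    ∑ x ∈ s.toFinset, s.count x * v x = (s.map v).sum := by
  simp [Finset.sum_multiset_map_count]

theorem count_mul_le_of_mem_weightedMultisets [DecidableEq α] (hs : s ∈ weightedMultisets v n)
    (x : α) : s.count x * v x ≤ n := by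
  by_cases hx : x ∈ s
  · rw [← hs.2, ← sum_count_mul_eq]
    exact Finset.single_le_sum (f := fun x => s.count x * v x) (fun _ _ => Nat.zero_le _)
      (Multiset.mem_toFinset.2 hx)
  · simp [Multiset.count_eq_zero_of_notMem hx]

theorem card_filter_antidiagonal_dvd_le_mul {v c n : ℕ} (hv : 0 < v) (hc : c * v ≤ n) :
    {kl ∈ antidiagonal n | v ∈ kl.1.divisors ∧ kl.1 ≤ c * v}.card = c := by
  have himage : {kl ∈ antidiagonal n | v ∈ kl.1.divisors ∧ kl.1 ≤ c * v} =
      (Finset.Icc 1 c).image fun j => (j * v, n - j * v) := by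
    ext ⟨k, l⟩
    simp only [Finset.mem_filter, mem_antidiagonal, Nat.mem_divisors, Finset.mem_image,
      Finset.mem_Icc, Prod.mk.injEq]
    constructor
    · rintro ⟨hkl, ⟨⟨j, rfl⟩, hne⟩, hle⟩
      rw [mul_comm] at hle
      refine ⟨j, ⟨Nat.pos_of_ne_zero (right_ne_zero_of_mul hne), ?_⟩, mul_comm _ _, ?_⟩
      · exact Nat.le_of_mul_le_mul_right hle hv
      · rw [mul_comm]; omega
    · rintro ⟨j, ⟨hj, hjc⟩, rfl, rfl⟩
      have hle : j * v ≤ c * v := Nat.mul_le_mul_right v hjc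
      exact ⟨Nat.add_sub_cancel' (hle.trans hc), ⟨Dvd.intro_left j rfl, by positivity⟩, hle⟩
  rw [himage, Finset.card_image_of_injective, Nat.card_Icc, Nat.add_sub_cancel]
  intro i j hij
  exact Nat.eq_of_mul_eq_mul_right hv (Prod.ext_iff.1 hij).1

theorem sum_count_weightedMultisets [DecidableEq α] (hfin : ∀ n, (weightedMultisets v n).Finite)
    (hx : 0 < v x) (n : ℕ) :
    ∑ s ∈ (hfin n).toFinset, s.count x =
      ∑ kl ∈ antidiagonal n with v x ∈ kl.1.divisors, (weightedMultisets v kl.2).ncard := by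
  have hcount : ∀ s ∈ (hfin n).toFinset, s.count x =
      ∑ kl ∈ antidiagonal n with v x ∈ kl.1.divisors,
        if kl.1 ≤ s.count x * v x then 1 else 0 := by
    intro s hs
    have hle := count_mul_le_of_mem_weightedMultisets ((hfin n).mem_toFinset.1 hs) x
    rw [← Finset.card_filter, Finset.filter_filter, card_filter_antidiagonal_dvd_le_mul hx hle]
  rw [Finset.sum_congr rfl hcount, Finset.sum_comm]
  refine Finset.sum_congr rfl fun ⟨k, m⟩ hkm => ?_
  simp only [Finset.mem_filter, mem_antidiagonal, Nat.mem_divisors] at hkm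
  obtain ⟨rfl, ⟨j, rfl⟩, -⟩ := hkm
  simp only [mul_comm (v x) j, Nat.mul_le_mul_right_iff hx]
  rw [← Finset.card_filter, card_filter_le_count hfin hx]

theorem finite_preimage_Icc_of_finite_weightedMultisets
    (hfin : ∀ n, (weightedMultisets v n).Finite) (n : ℕ) : (v ⁻¹' Set.Icc 1 n).Finite := by
  have hunion : v ⁻¹' Set.Icc 1 n = ⋃ l ∈ Set.Icc 1 n, v ⁻¹' {l} := by
    ext x
    simp
  rw [hunion]
  exact (Set.finite_Icc 1 n).biUnion fun l hl =>
    finite_fibre_of_finite_weightedMultisets hfin (Nat.pos_iff_ne_zero.1 hl.1)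

theorem sum_count_mul_eq_of_mem_weightedMultisets [DecidableEq α]
    (hfin : (v ⁻¹' Set.Icc 1 n).Finite) (hs : s ∈ weightedMultisets v n) :
    ∑ x ∈ hfin.toFinset, v x * s.count x = n := by
  simp only [mul_comm (v _)]
  refine Eq.trans (Eq.symm ?_) ((sum_count_mul_eq s).trans hs.2)
  refine Finset.sum_subset (fun x hx => ?_) fun x _ hx => ?_
  · rw [Multiset.mem_toFinset] at hx
    rw [Set.Finite.mem_toFinset]
    exact ⟨hs.1 x hx, apply_le_of_mem_weightedMultisets hs hx⟩
  · rw [Multiset.mem_toFinset] at hx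
    simp [Multiset.count_eq_zero_of_notMem hx]

theorem sum_filter_apply_mem_eq_sum_mul_ncard {X : Finset α} {D : Finset ℕ}
    (hX : ∀ x, v x ∈ D → x ∈ X) :
    ∑ x ∈ X with v x ∈ D, v x = ∑ l ∈ D, l * (v ⁻¹' {l}).ncard := by
  classical
  rw [← Finset.sum_fiberwise_of_maps_to (t := D) (g := v) fun x hx => (Finset.mem_filter.1 hx).2]
  refine Finset.sum_congr rfl fun l hl => ?_
  rw [Finset.sum_congr rfl fun x hx => (Finset.mem_filter.1 hx).2, Finset.sum_const, smul_eq_mul,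
    mul_comm, ← Set.ncard_coe_finset]
  congr 2
  ext x
  simp only [Finset.coe_filter, Finset.mem_filter, Set.mem_ofPred_eq, Set.mem_preimage,
    Set.mem_singleton_iff, and_iff_right_iff_imp]
  rintro rfl
  exact ⟨hX x hl, hl⟩

/-- The recurrence for the coefficients of `∏ (1 - z ^ v x)⁻¹` given by its logarithmic derivative,
proved by counting the pairs of a multiset of total weight `n` and an element of it. -/
theorem mul_ncard_weightedMultisets (hfin : ∀ n, (weightedMultisets v n).Finite) (n : ℕ) :
    n * (weightedMultisets v n).ncard = ∑ kl ∈ antidiagonal n,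
      (∑ l ∈ kl.1.divisors, l * (v ⁻¹' {l}).ncard) * (weightedMultisets v kl.2).ncard := by
  classical
  have hX := finite_preimage_Icc_of_finite_weightedMultisets hfin n
  calc n * (weightedMultisets v n).ncard
      = ∑ s ∈ (hfin n).toFinset, ∑ x ∈ hX.toFinset, v x * s.count x := by
        rw [Finset.sum_congr rfl fun s hs => sum_count_mul_eq_of_mem_weightedMultisets hX
          ((hfin n).mem_toFinset.1 hs), Finset.sum_const, smul_eq_mul, mul_comm,
          Set.ncard_eq_toFinset_card _ (hfin n)]
    _ = ∑ x ∈ hX.toFinset, ∑ kl ∈ antidiagonal n with v x ∈ kl.1.divisors,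
          v x * (weightedMultisets v kl.2).ncard := by
        rw [Finset.sum_comm]
        refine Finset.sum_congr rfl fun x hx => ?_
        have hpos : 0 < v x := (hX.mem_toFinset.1 hx).1
        rw [← Finset.mul_sum, sum_count_weightedMultisets hfin hpos, Finset.mul_sum]
    _ = ∑ kl ∈ antidiagonal n, (∑ x ∈ hX.toFinset with v x ∈ kl.1.divisors, v x) *
          (weightedMultisets v kl.2).ncard := by
        simp only [Finset.sum_filter, Finset.sum_mul, ite_mul, zero_mul]
        exact Finset.sum_comm
    _ = _ := by
        refine Finset.sum_congr rfl fun kl hkl => ?_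
        rw [sum_filter_apply_mem_eq_sum_mul_ncard fun x hx => hX.mem_toFinset.2 ?_]
        have hle : kl.1 ≤ n := le_self_add.trans_eq (mem_antidiagonal.1 hkl)
        exact ⟨Nat.pos_of_mem_divisors hx, (Nat.divisor_le hx).trans hle⟩

end WeightedMultisets

/-! ### Generalized partitions -/

theorem genPartitions_eq_weightedMultisets (n : ℕ) :
    genPartitions n = weightedMultisets (fun x : ℕ × ℕ => x.1 * x.2) n := by
  simp only [genPartitions, weightedMultisets, CanonicallyOrderedAdd.mul_pos]

theorem ncard_setOf_mul_eq {l : ℕ} (hl : l ≠ 0) :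
    ((fun x : ℕ × ℕ => x.1 * x.2) ⁻¹' {l}).ncard = l.divisors.card := by
  have hfibre : (fun x : ℕ × ℕ => x.1 * x.2) ⁻¹' {l} = l.divisorsAntidiagonal := by
    ext x
    simp [hl]
  rw [hfibre, Set.ncard_coe_finset, ← Nat.map_div_right_divisors, Finset.card_map]

/-- The arithmetic function `k ↦ ∑_{ℓ ∣ k} ℓ d(ℓ)`, with Dirichlet series `ζ(s) ζ(s-1)²`. -/
def weight (k : ℕ) : ℕ := ∑ l ∈ k.divisors, l * l.divisors.card

theorem mul_p_eq_sum (n : ℕ) : n * p n = ∑ kl ∈ antidiagonal n, weight kl.1 * p kl.2 := by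
  have hfin := genPartitions_finite
  simp only [p, genPartitions_eq_weightedMultisets] at hfin ⊢
  rw [mul_ncard_weightedMultisets hfin]
  refine Finset.sum_congr rfl fun kl _ => congrArg (· * _) (Finset.sum_congr rfl fun l hl => ?_)
  rw [ncard_setOf_mul_eq (Nat.pos_of_mem_divisors hl).ne']

theorem p_zero : p 0 = 1 := by
  rw [p, genPartitions_eq_weightedMultisets, weightedMultisets_zero, Set.ncard_singleton]

theorem q_le_p (n : ℕ) : q n ≤ p n :=
  Set.ncard_le_ncard (fun _ hs => hs.1) (genPartitions_finite n)

theorem gcd_map_fst_mem_Icc {n : ℕ} (hn : n ≠ 0) {s : Multiset (ℕ × ℕ)}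
    (hs : s ∈ genPartitions n) : (s.map Prod.fst).gcd ∈ Finset.Icc 1 n := by
  obtain ⟨x, hx⟩ : ∃ x, x ∈ s := Multiset.exists_mem_of_ne_zero fun hzero => hn <| by
    simpa [hzero] using hs.2.symm
  obtain ⟨hfst, hsnd⟩ := hs.1 x hx
  have hdvd : (s.map Prod.fst).gcd ∣ x.1 := Multiset.gcd_dvd (Multiset.mem_map_of_mem _ hx)
  have hle : x.1 * x.2 ≤ n :=
    apply_le_of_mem_weightedMultisets (v := fun x : ℕ × ℕ => x.1 * x.2)
      (genPartitions_eq_weightedMultisets n ▸ hs) hx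
  exact Finset.mem_Icc.2 ⟨Nat.pos_of_dvd_of_pos hdvd hfst, (Nat.le_of_dvd hfst hdvd).trans
    ((Nat.le_mul_of_pos_right _ hsnd).trans hle)⟩

theorem mem_image_genPartitions_div {n d : ℕ} (hd : 0 < d) {s : Multiset (ℕ × ℕ)}
    (hs : s ∈ genPartitions n) (hdvd : ∀ x ∈ s, d ∣ x.1) :
    s ∈ (Multiset.map fun x => (d * x.1, x.2)) '' genPartitions (n / d) := by
  have hmap : (s.map fun x => (x.1 / d, x.2)).map (fun x => (d * x.1, x.2)) = s := by
    rw [Multiset.map_map]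
    conv_rhs => rw [← Multiset.map_id s]
    exact Multiset.map_congr rfl fun x hx => by simp [Nat.mul_div_cancel' (hdvd x hx)]
  refine ⟨s.map fun x => (x.1 / d, x.2), ⟨fun y hy => ?_, ?_⟩, hmap⟩
  · obtain ⟨x, hx, rfl⟩ := Multiset.mem_map.1 hy
    obtain ⟨hfst, hsnd⟩ := hs.1 x hx
    exact ⟨Nat.div_pos (Nat.le_of_dvd hfst (hdvd x hx)) hd, hsnd⟩
  · have hsum := hs.2
    rw [← hmap] at hsum
    simp only [Multiset.map_map _ _ (s.map _), Function.comp_def, mul_assoc,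
      Multiset.sum_map_mul_left] at hsum
    rw [← hsum, Nat.mul_div_cancel_left _ hd]

theorem genPartitions_subset_prim_union_images {n : ℕ} (hn : n ≠ 0) :
    genPartitions n ⊆ primGenPartitions n ∪
      ⋃ d ∈ Finset.Icc 2 n, (Multiset.map fun x => (d * x.1, x.2)) '' genPartitions (n / d) := by
  intro s hs
  have hgcd := Finset.mem_Icc.1 (gcd_map_fst_mem_Icc hn hs)
  rcases hgcd.1.eq_or_lt with hone | htwo
  · exact .inl ⟨hs, hone.symm⟩
  · exact .inr (Set.mem_biUnion (Finset.mem_Icc.2 ⟨htwo, hgcd.2⟩)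
      (mem_image_genPartitions_div hgcd.1 hs fun x hx =>
        Multiset.gcd_dvd (Multiset.mem_map_of_mem _ hx)))

theorem p_le_q_add_sum {n : ℕ} (hn : n ≠ 0) :
    p n ≤ q n + ∑ d ∈ Finset.Icc 2 n, p (n / d) := by
  have hfin : (primGenPartitions n ∪ ⋃ d ∈ Finset.Icc 2 n,
      (Multiset.map fun x => (d * x.1, x.2)) '' genPartitions (n / d)).Finite :=
    ((genPartitions_finite n).subset fun _ hs => hs.1).union
      ((Finset.finite_toSet _).biUnion fun d _ => (genPartitions_finite _).image _)
  calc p n ≤ _ := Set.ncard_le_ncard (genPartitions_subset_prim_union_images hn) hfin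
    _ ≤ q n + _ := Set.ncard_union_le _ _
    _ ≤ _ := by
      gcongr
      refine (Finset.set_ncard_biUnion_le _ _).trans (Finset.sum_le_sum fun d _ => ?_)
      exact Set.ncard_image_le (genPartitions_finite _)

theorem weight_zero : weight 0 = 0 := by simp [weight]

theorem le_weight (k : ℕ) : k ≤ weight k := by
  rcases Nat.eq_zero_or_pos k with rfl | hk
  · exact Nat.zero_le _
  · have hmem : k ∈ k.divisors := Nat.mem_divisors_self k hk.ne'
    calc k ≤ k * k.divisors.card := Nat.le_mul_of_pos_right _ (Finset.card_pos.2 ⟨k, hmem⟩)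
      _ ≤ weight k := Finset.single_le_sum (f := fun l => l * l.divisors.card)
          (fun _ _ => Nat.zero_le _) hmem

open LSeries.notation in
theorem natCast_convolution_natCast (l : ℕ) :
    ((fun n : ℕ => (n : ℂ)) ⍟ (fun n : ℕ => (n : ℂ))) l = l * l.divisors.card := by
  have hconst : ∀ x ∈ l.divisorsAntidiagonal, (x.1 : ℂ) * x.2 = l := fun x hx =>
    mod_cast (Nat.mem_divisorsAntidiagonal.1 hx).1
  simp only [LSeries.convolution_def]
  rw [Finset.sum_congr rfl hconst, Finset.sum_const, nsmul_eq_mul,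
    mul_comm, ← Nat.map_div_right_divisors, Finset.card_map]

open LSeries.notation in
theorem convolution_one_eq_weight (k : ℕ) :
    (((fun n : ℕ => (n : ℂ)) ⍟ (fun n : ℕ => (n : ℂ))) ⍟ (1 : ℕ → ℂ)) k = weight k := by
  simp only [LSeries.convolution_def (_ ⍟ _), Pi.one_apply, mul_one, natCast_convolution_natCast]
  rw [Nat.sum_divisorsAntidiagonal (f := fun l _ => (l : ℂ) * l.divisors.card), weight]
  push_cast
  rfl

theorem summable_weight_mul_rpow {s : ℝ} (hs : 2 < s) :
    Summable fun k : ℕ => (weight k : ℝ) * (k : ℝ) ^ (-s) := by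
  have hid : LSeriesSummable (fun n : ℕ => (n : ℂ)) s :=
    LSeriesSummable_of_le_const_mul_rpow (x := 2) (by simpa using hs) ⟨1, fun n _ => by norm_num⟩
  have hone : LSeriesSummable (1 : ℕ → ℂ) s := LSeriesSummable_one_iff.2 (by simp; linarith)
  refine ((hid.convolution hid).convolution hone).norm.congr fun k => ?_
  rcases Nat.eq_zero_or_pos k with rfl | hk
  · simp [weight_zero]
  · rw [LSeries.norm_term_eq, if_neg hk.ne', convolution_one_eq_weight,
      Real.rpow_neg (Nat.cast_nonneg k)]
    simp [div_eq_mul_inv]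

/-! ### Moments of an admissible sequence -/

/-- The sequences `c` for which the saddle-point method applies to `exp (∑ c k z ^ k)`: they are
bounded below by one away from `0` and have a Dirichlet series converging at some `σ < 3 / 2`. -/
structure IsAdmissible (c : ℕ → ℝ) (σ : ℝ) : Prop where
  map_zero : c 0 = 0
  one_le : ∀ k ≠ 0, 1 ≤ c k
  summable : Summable fun k : ℕ => c k * (k : ℝ) ^ (-σ)
  lt : σ < 3 / 2

/-- The `k`-th term of `moment c j ω`. -/
noncomputable def momentTerm (c : ℕ → ℝ) (j : ℕ) (ω : ℝ) (k : ℕ) : ℝ :=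
  c k * (k : ℝ) ^ j * Real.exp (-(k : ℝ) / ω)

/-- The `j`-th derivative of `t ↦ ∑ c k e ^ (-k t)` at `t = 1 / ω`, up to sign. In the notation of
the main theorem it is `S_{j-1}` for `c k = k⁻¹ ∑_{ℓ ∣ k} ℓ d(ℓ)`. -/
noncomputable def moment (c : ℕ → ℝ) (j : ℕ) (ω : ℝ) : ℝ := ∑' k, momentTerm c j ω k

theorem exp_neg_le_rpow {a x : ℝ} (ha : 0 < a) (hx : 0 < x) :
    Real.exp (-x) ≤ a ^ a * x ^ (-a) := by
  have hdiv : x / a ≤ Real.exp (x / a) := by linarith [Real.add_one_le_exp (x / a)]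
  have hpow : x ^ a ≤ a ^ a * Real.exp x := by
    calc x ^ a = a ^ a * (x / a) ^ a := by
          rw [← Real.mul_rpow ha.le (by positivity), mul_div_cancel₀ _ ha.ne']
      _ ≤ a ^ a * Real.exp (x / a) ^ a := by gcongr
      _ = a ^ a * Real.exp x := by rw [← Real.exp_mul, div_mul_cancel₀ _ ha.ne']
  rw [Real.exp_neg, Real.rpow_neg hx.le, ← div_eq_mul_inv, le_div_iff₀ (by positivity),
    inv_mul_le_iff₀ (Real.exp_pos x), mul_comm]
  exact hpow

namespace IsAdmissible

variable {c : ℕ → ℝ} {σ : ℝ} {ω : ℝ}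

theorem nonneg (hc : IsAdmissible c σ) (k : ℕ) : 0 ≤ c k := by
  rcases eq_or_ne k 0 with rfl | hk
  · exact hc.map_zero.ge
  · exact zero_le_one.trans (hc.one_le k hk)

theorem one_lt (hc : IsAdmissible c σ) : 1 < σ := by
  have hle : ∀ k : ℕ, ((k + 1 : ℕ) : ℝ) ^ (-σ) ≤ c (k + 1) * ((k + 1 : ℕ) : ℝ) ^ (-σ) := fun k =>
    le_mul_of_one_le_left (by positivity) (hc.one_le _ k.succ_ne_zero)
  have hsum := Summable.of_nonneg_of_le (fun k => by positivity) hle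
    ((summable_nat_add_iff 1).2 hc.summable)
  have hσ := Real.summable_nat_rpow.1 ((summable_nat_add_iff 1).1 hsum)
  linarith

theorem momentTerm_nonneg (hc : IsAdmissible c σ) (j : ℕ) (ω : ℝ) (k : ℕ) :
    0 ≤ momentTerm c j ω k := by
  have := hc.nonneg k
  unfold momentTerm
  positivity

theorem momentTerm_le (hc : IsAdmissible c σ) (j : ℕ) (hω : 0 < ω) (k : ℕ) :
    momentTerm c j ω k ≤
      (j + σ) ^ (j + σ) * ω ^ (j + σ) * (c k * (k : ℝ) ^ (-σ)) := by
  rcases Nat.eq_zero_or_pos k with rfl | hk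
  · simp [momentTerm, hc.map_zero]
  have hk' : (0 : ℝ) < k := mod_cast hk
  have hck := hc.nonneg k
  have hσ := hc.one_lt
  set a : ℝ := j + σ
  have hexp := exp_neg_le_rpow (a := a) (by positivity) (div_pos hk' hω)
  have hdiv : ((k : ℝ) / ω) ^ (-a) = (k : ℝ) ^ (-a) * ω ^ a := by
    rw [Real.div_rpow hk'.le hω.le, Real.rpow_neg hω.le, div_inv_eq_mul]
  have hpow : (k : ℝ) ^ j * (k : ℝ) ^ (-a) = (k : ℝ) ^ (-σ) := by
    rw [← Real.rpow_natCast, ← Real.rpow_add hk']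
    congr 1
    ring
  calc momentTerm c j ω k
      ≤ c k * (k : ℝ) ^ j * (a ^ a * ((k : ℝ) / ω) ^ (-a)) := by
        rw [momentTerm, neg_div]
        gcongr
    _ = a ^ a * ω ^ a * (c k * ((k : ℝ) ^ j * (k : ℝ) ^ (-a))) := by rw [hdiv]; ring
    _ = a ^ a * ω ^ a * (c k * (k : ℝ) ^ (-σ)) := by rw [hpow]

theorem summable_momentTerm (hc : IsAdmissible c σ) (j : ℕ) (hω : 0 < ω) :
    Summable (momentTerm c j ω) :=
  .of_nonneg_of_le (hc.momentTerm_nonneg j ω) (hc.momentTerm_le j hω) (hc.summable.mul_left _)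

theorem exists_moment_le (hc : IsAdmissible c σ) (j : ℕ) :
    ∃ C > 0, ∀ ω : ℝ, 0 < ω → moment c j ω ≤ C * ω ^ (j + σ) := by
  have hσ := hc.one_lt
  have hnonneg : 0 ≤ ∑' k : ℕ, c k * (k : ℝ) ^ (-σ) := tsum_nonneg fun k =>
    mul_nonneg (hc.nonneg k) (by positivity)
  refine ⟨(j + σ) ^ (j + σ) * (∑' k : ℕ, c k * (k : ℝ) ^ (-σ) + 1), by positivity,
    fun ω hω => ?_⟩
  calc moment c j ω ≤ (j + σ) ^ (j + σ) * ω ^ (j + σ) * ∑' k : ℕ, c k * (k : ℝ) ^ (-σ) := by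
        rw [← tsum_mul_left]
        exact (hc.summable_momentTerm j hω).tsum_le_tsum (hc.momentTerm_le j hω)
          (hc.summable.mul_left _)
    _ = (j + σ) ^ (j + σ) * (∑' k : ℕ, c k * (k : ℝ) ^ (-σ)) * ω ^ (j + σ) := by ring
    _ ≤ _ := by gcongr; linarith

theorem le_momentTerm (hc : IsAdmissible c σ) (j : ℕ) (hω : 1 ≤ ω) {k : ℕ} (hk : ω ≤ k)
    (hk' : k ≤ 4 * ω) : Real.exp (-4) * ω ^ j ≤ momentTerm c j ω k := by
  have hω0 : 0 < ω := by linarith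
  have hck : 1 ≤ c k := hc.one_le k (by rintro rfl; norm_num at hk; linarith)
  have hexp : Real.exp (-4) ≤ Real.exp (-(k : ℝ) / ω) := by
    rw [Real.exp_le_exp, neg_div, neg_le_neg_iff, div_le_iff₀ hω0]
    exact hk'
  calc Real.exp (-4) * ω ^ j ≤ Real.exp (-(k : ℝ) / ω) * (1 * (k : ℝ) ^ j) := by
        rw [one_mul]; gcongr
    _ ≤ Real.exp (-(k : ℝ) / ω) * (c k * (k : ℝ) ^ j) := by gcongr
    _ = momentTerm c j ω k := by rw [momentTerm]; ring

theorem le_moment (hc : IsAdmissible c σ) (j : ℕ) (hω : 1 ≤ ω) :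
    Real.exp (-4) * ω ^ (j + 1) ≤ moment c j ω := by
  have hω0 : 0 < ω := by linarith
  set N := ⌈ω⌉₊
  have hωN : ω ≤ N := Nat.le_ceil ω
  have hNω : (N : ℝ) ≤ 2 * ω := by linarith [(Nat.ceil_lt_add_one hω0.le).le]
  have hterm : ∀ k ∈ Finset.Ioc N (2 * N), Real.exp (-4) * ω ^ j ≤ momentTerm c j ω k := by
    intro k hk
    rw [Finset.mem_Ioc] at hk
    have hNk : (N : ℝ) ≤ k := mod_cast hk.1.le
    have hkN : (k : ℝ) ≤ 2 * N := mod_cast hk.2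
    exact hc.le_momentTerm j hω (by linarith) (by linarith)
  calc Real.exp (-4) * ω ^ (j + 1) = ω * (Real.exp (-4) * ω ^ j) := by ring
    _ ≤ N * (Real.exp (-4) * ω ^ j) := by gcongr
    _ = (Finset.Ioc N (2 * N)).card • (Real.exp (-4) * ω ^ j) := by
        rw [Nat.card_Ioc, two_mul, Nat.add_sub_cancel, nsmul_eq_mul]
    _ ≤ ∑ k ∈ Finset.Ioc N (2 * N), momentTerm c j ω k :=
        Finset.card_nsmul_le_sum _ _ _ hterm
    _ ≤ moment c j ω := (hc.summable_momentTerm j hω0).sum_le_tsum _ fun k _ =>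
        hc.momentTerm_nonneg j ω k

theorem moment_pos (hc : IsAdmissible c σ) (j : ℕ) (hω : 1 ≤ ω) : 0 < moment c j ω :=
  (by positivity : (0 : ℝ) < Real.exp (-4) * ω ^ (j + 1)).trans_le (hc.le_moment j hω)

theorem momentTerm_mono (hc : IsAdmissible c σ) (j k : ℕ) {ω₁ ω₂ : ℝ} (hω₁ : 0 < ω₁)
    (hle : ω₁ ≤ ω₂) : momentTerm c j ω₁ k ≤ momentTerm c j ω₂ k := by
  have := hc.nonneg k
  simp only [momentTerm, neg_div]
  gcongr

theorem strictMonoOn_moment (hc : IsAdmissible c σ) (j : ℕ) :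
    StrictMonoOn (moment c j) (Set.Ioi 0) := by
  intro ω₁ (hω₁ : 0 < ω₁) ω₂ (hω₂ : 0 < ω₂) hlt
  refine Summable.tsum_lt_tsum (i := 1) (fun k => hc.momentTerm_mono j k hω₁ hlt.le) ?_
    (hc.summable_momentTerm j hω₁) (hc.summable_momentTerm j hω₂)
  have hc1 : 0 < c 1 := zero_lt_one.trans_le (hc.one_le 1 one_ne_zero)
  simp only [momentTerm, neg_div]
  gcongr

theorem continuousOn_moment (hc : IsAdmissible c σ) (j : ℕ) :
    ContinuousOn (moment c j) (Set.Ioi 0) := by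
  have hIoc : ∀ b > 0, ContinuousOn (moment c j) (Set.Ioc 0 b) := fun b hb => by
    refine continuousOn_tsum (u := momentTerm c j b) (fun k => ?_) (hc.summable_momentTerm j hb)
      fun k ω hω => ?_
    · exact continuousOn_const.mul (Real.continuous_exp.comp_continuousOn
        (continuousOn_const.div continuousOn_id fun ω hω => hω.1.ne'))
    · rw [Real.norm_of_nonneg (hc.momentTerm_nonneg _ _ _)]
      exact hc.momentTerm_mono j k hω.1 hω.2
  intro ω (hω : 0 < ω)
  refine ((hIoc (ω + 1) (by linarith)).continuousAt ?_).continuousWithinAt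
  exact Ioc_mem_nhds hω (lt_add_one ω)

theorem tendsto_moment_nhdsGT_zero (hc : IsAdmissible c σ) (j : ℕ) :
    Tendsto (moment c j) (𝓝[>] 0) (𝓝 0) := by
  obtain ⟨C, -, hC⟩ := hc.exists_moment_le j
  have hpow : Tendsto (fun ω : ℝ => C * ω ^ (j + σ)) (𝓝[>] 0) (𝓝 0) := by
    have hexp : 0 < j + σ := by linarith [hc.one_lt, j.cast_nonneg (α := ℝ)]
    have h := ((Real.continuousAt_rpow_const 0 _ (.inr hexp.le)).tendsto.const_mul C).mono_left
      (nhdsWithin_le_nhds (s := Set.Ioi 0))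
    rwa [Real.zero_rpow hexp.ne', mul_zero] at h
  refine squeeze_zero' (.of_forall fun ω => tsum_nonneg (hc.momentTerm_nonneg j ω)) ?_ hpow
  filter_upwards [self_mem_nhdsWithin] with ω hω using hC ω hω

theorem tendsto_moment_atTop (hc : IsAdmissible c σ) (j : ℕ) :
    Tendsto (moment c j) atTop atTop := by
  have hpow : Tendsto (fun ω : ℝ => Real.exp (-4) * ω ^ (j + 1)) atTop atTop :=
    (tendsto_pow_atTop j.succ_ne_zero).const_mul_atTop (Real.exp_pos _)
  refine tendsto_atTop_mono' _ ?_ hpow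
  filter_upwards [eventually_ge_atTop 1] with ω hω using hc.le_moment j hω

theorem existsUnique_moment_eq (hc : IsAdmissible c σ) (j : ℕ) {y : ℝ} (hy : 0 < y) :
    ∃! ω : ℝ, 0 < ω ∧ moment c j ω = y := by
  obtain ⟨ω, hω, rfl⟩ := isPreconnected_Ioi.intermediate_value_Ioi (l₁ := 𝓝[>] 0)
    inf_le_right (le_principal_iff.2 (Ioi_mem_atTop 0)) (hc.continuousOn_moment j)
    (hc.tendsto_moment_nhdsGT_zero j) (hc.tendsto_moment_atTop j) hy
  exact ⟨ω, ⟨hω, rfl⟩, fun ω' h => (hc.strictMonoOn_moment j).injOn h.1 hω h.2⟩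

theorem tendsto_atTop_of_tendsto_moment (hc : IsAdmissible c σ) {ι : Type*} {l : Filter ι}
    {ω : ι → ℝ} {j : ℕ} (hω : ∀ᶠ i in l, 0 < ω i)
    (hmoment : Tendsto (fun i => moment c j (ω i)) l atTop) : Tendsto ω l atTop := by
  refine tendsto_atTop.2 fun b => ?_
  filter_upwards [hω, hmoment.eventually_ge_atTop (moment c j (max b 1))] with i hωi hle
  exact (le_max_left b 1).trans
    (((hc.strictMonoOn_moment j).le_iff_le (by simp) hωi).1 hle)

end IsAdmissible

/-! ### Exponentials of power series -/

theorem hasFPowerSeriesOnBall_tsum_mul_pow {c : ℕ → ℂ}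
    (hc : ∀ z : ℂ, ‖z‖ < 1 → Summable fun k => ‖c k * z ^ k‖) :
    HasFPowerSeriesOnBall (fun z => ∑' k, c k * z ^ k)
      (FormalMultilinearSeries.ofScalars ℂ c) 0 1 := by
  set P := FormalMultilinearSeries.ofScalars ℂ c with hP
  have hradius : 1 ≤ P.radius := by
    refine ENNReal.le_of_forall_nnreal_lt fun r hr => P.le_radius_of_summable ?_
    have hr' : (r : ℝ) < 1 := mod_cast hr
    refine (hc r (by simpa using hr')).congr fun k => ?_
    rw [norm_mul, hP, FormalMultilinearSeries.ofScalars_norm]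
    simp
  have hsum : P.sum = fun z => ∑' k, c k * z ^ k := by
    funext z
    simp only [FormalMultilinearSeries.sum, hP, FormalMultilinearSeries.ofScalars_apply_eq,
      smul_eq_mul]
  rw [← hsum]
  exact (P.hasFPowerSeriesOnBall (one_pos.trans_le hradius)).mono one_pos hradius

theorem iteratedDeriv_zero_tsum_mul_pow {c : ℕ → ℂ}
    (hc : ∀ z : ℂ, ‖z‖ < 1 → Summable fun k => ‖c k * z ^ k‖) (n : ℕ) :
    iteratedDeriv n (fun z => ∑' k, c k * z ^ k) 0 = n.factorial * c n := by
  have h := (hasFPowerSeriesOnBall_tsum_mul_pow hc).factorial_smul 1 n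
  rw [iteratedFDeriv_apply_eq_iteratedDeriv_mul_prod, Finset.prod_const_one, one_smul] at h
  rw [← h, FormalMultilinearSeries.ofScalars_apply_eq]
  simp

/-- `b` is the coefficient sequence of `exp (∑ c k z ^ k)`, where `c 0 = 0`, expressed by the
recurrence coming from the logarithmic derivative. -/
structure IsExpCoeff (c b : ℕ → ℝ) : Prop where
  zero : b 0 = 1
  mul_eq_sum : ∀ n : ℕ, n * b n = ∑ kl ∈ antidiagonal n, kl.1 * c kl.1 * b kl.2

theorem deriv_cexp_comp_eventuallyEq {f : ℂ → ℂ} {z : ℂ} (hf : AnalyticAt ℂ f z) :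
    deriv (fun z => Complex.exp (f z)) =ᶠ[𝓝 z] deriv f * Complex.exp ∘ f := by
  filter_upwards [hf.eventually_analyticAt] with w hw
  rw [hw.differentiableAt.hasDerivAt.cexp.deriv, Pi.mul_apply, mul_comm, Function.comp_apply]

theorem IsExpCoeff.iteratedDeriv_cexp_comp {c b : ℕ → ℝ} (hb : IsExpCoeff c b) {f : ℂ → ℂ}
    (hf : AnalyticAt ℂ f 0) (hf0 : f 0 = 0)
    (hcoeff : ∀ n, iteratedDeriv n f 0 = n.factorial * c n) (n : ℕ) :
    iteratedDeriv n (fun z => Complex.exp (f z)) 0 = n.factorial * b n := by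
  induction n using Nat.strong_induction_on with
  | _ n ih =>
    rcases n with _ | n
    · simp [hf0, hb.zero]
    have hrec : (n + 1 : ℂ) * b (n + 1) =
        ∑ kl ∈ antidiagonal n, (kl.1 + 1 : ℂ) * c (kl.1 + 1) * b kl.2 := by
      have h := hb.mul_eq_sum (n + 1)
      rw [Finset.Nat.sum_antidiagonal_succ] at h
      simp only [CharP.cast_eq_zero, zero_mul, zero_add] at h
      exact_mod_cast h
    rw [iteratedDeriv_succ', (deriv_cexp_comp_eventuallyEq hf).iteratedDeriv_eq,
      iteratedDeriv_mul hf.deriv.contDiffAt hf.cexp.contDiffAt, Nat.factorial_succ, Nat.cast_mul,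
      mul_comm ((n + 1 : ℕ) : ℂ), mul_assoc, Nat.cast_succ, hrec, Finset.mul_sum,
      Finset.Nat.sum_antidiagonal_eq_sum_range_succ_mk]
    refine Finset.sum_congr rfl fun i hi => ?_
    have hin : i ≤ n := Nat.lt_succ_iff.1 (Finset.mem_range.1 hi)
    rw [← iteratedDeriv_succ', hcoeff, Function.comp_def, ih (n - i) (by omega),
      ← Nat.choose_mul_factorial_mul_factorial hin, Nat.factorial_succ]
    push_cast
    ring

theorem integral_circleMap_div_pow {f : ℂ → ℂ} {r : ℝ} (hr : 0 < r)
    (hf : DifferentiableOn ℂ f (Metric.closedBall 0 r)) (n : ℕ) :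
    ∫ θ in (-π)..π, f (circleMap 0 r θ) / circleMap 0 r θ ^ n =
      2 * π * (iteratedDeriv n f 0 / n.factorial) := by
  have hper : Function.Periodic (fun θ => f (circleMap 0 r θ) / circleMap 0 r θ ^ n) (2 * π) :=
    fun θ => by simp only [periodic_circleMap 0 r θ]
  have hintegrand : ∀ θ, deriv (circleMap 0 r) θ • (1 / (circleMap 0 r θ - 0) ^ (n + 1)) •
      f (circleMap 0 r θ) = Complex.I * (f (circleMap 0 r θ) / circleMap 0 r θ ^ n) := by
    intro θ
    have hne : circleMap 0 r θ ≠ 0 := circleMap_ne_center hr.ne'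
    simp only [deriv_circleMap, sub_zero, smul_eq_mul]
    field_simp
    ring
  have hcauchy := hf.circleIntegral_one_div_sub_center_pow_smul hr n
  simp only [circleIntegral, hintegrand, intervalIntegral.integral_const_mul] at hcauchy
  have hshift := hper.intervalIntegral_add_eq (-π) 0
  rw [show -π + 2 * π = π by ring, zero_add] at hshift
  rw [hshift]
  refine mul_left_cancel₀ Complex.I_ne_zero (hcauchy.trans ?_)
  rw [smul_eq_mul]
  ring

/-- The logarithm `∑ c k z ^ k` of the generating function, on the unit disc. -/
noncomputable def logGen (c : ℕ → ℝ) (z : ℂ) : ℂ := ∑' k, (c k : ℂ) * z ^ k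

theorem logGen_exp_eq_moment (c : ℕ → ℝ) (ω : ℝ) :
    logGen c (Real.exp (-1 / ω) : ℝ) = moment c 0 ω := by
  rw [moment, Complex.ofReal_tsum]
  refine tsum_congr fun k => ?_
  rw [← Complex.ofReal_pow, ← Complex.ofReal_mul, momentTerm, ← Real.exp_nat_mul, pow_zero, mul_one,
    mul_div_assoc', mul_neg_one]

theorem exp_neg_one_div_lt_one {ω : ℝ} (hω : 0 < ω) : Real.exp (-1 / ω) < 1 :=
  Real.exp_lt_one_iff.2 (div_neg_of_neg_of_pos (by norm_num) hω)

namespace IsAdmissible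

variable {c : ℕ → ℝ} {σ : ℝ} {ω : ℝ}

theorem logGen_zero (hc : IsAdmissible c σ) : logGen c 0 = 0 := by
  rw [logGen, tsum_eq_single 0 fun k hk => by simp [hk]]
  simp [hc.map_zero]

theorem summable_norm_logGen (hc : IsAdmissible c σ) {z : ℂ} (hz : ‖z‖ < 1) :
    Summable fun k => ‖(c k : ℂ) * z ^ k‖ := by
  have hω : 0 < (1 - ‖z‖)⁻¹ := inv_pos.2 (by linarith)
  refine (hc.summable_momentTerm 0 hω).of_nonneg_of_le (fun k => norm_nonneg _) fun k => ?_
  have hle : ‖z‖ ≤ Real.exp (-(1 - ‖z‖)) := by linarith [Real.add_one_le_exp (-(1 - ‖z‖))]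
  have hck := hc.nonneg k
  calc ‖(c k : ℂ) * z ^ k‖ ≤ c k * Real.exp (-(1 - ‖z‖)) ^ k := by
        rw [norm_mul, norm_pow, Complex.norm_of_nonneg hck]
        gcongr
    _ = momentTerm c 0 (1 - ‖z‖)⁻¹ k := by
        rw [momentTerm, ← Real.exp_nat_mul, pow_zero, mul_one, div_inv_eq_mul, mul_neg, neg_mul]

theorem analyticAt_logGen (hc : IsAdmissible c σ) {z : ℂ} (hz : ‖z‖ < 1) :
    AnalyticAt ℂ (logGen c) z := by
  refine (hasFPowerSeriesOnBall_tsum_mul_pow fun z => hc.summable_norm_logGen).analyticAt_of_mem ?_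
  rwa [Metric.mem_eball, edist_zero_right, ← ofReal_norm, ENNReal.ofReal_lt_one]

theorem differentiableOn_cexp_logGen (hc : IsAdmissible c σ) :
    DifferentiableOn ℂ (fun z => Complex.exp (logGen c z)) (Metric.ball 0 1) := fun _ hz =>
  (hc.analyticAt_logGen (mem_ball_zero_iff.1 hz)).cexp.differentiableAt.differentiableWithinAt

theorem iteratedDeriv_cexp_logGen (hc : IsAdmissible c σ) {b : ℕ → ℝ} (hb : IsExpCoeff c b)
    (n : ℕ) : iteratedDeriv n (fun z => Complex.exp (logGen c z)) 0 = n.factorial * b n :=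
  hb.iteratedDeriv_cexp_comp (hc.analyticAt_logGen (by simp)) hc.logGen_zero
    (iteratedDeriv_zero_tsum_mul_pow fun _ => hc.summable_norm_logGen) n

theorem integral_cexp_logGen_div_pow (hc : IsAdmissible c σ) {b : ℕ → ℝ} (hb : IsExpCoeff c b)
    {r : ℝ} (hr : 0 < r) (hr1 : r < 1) (n : ℕ) :
    ∫ θ in (-π)..π, Complex.exp (logGen c (circleMap 0 r θ)) / circleMap 0 r θ ^ n =
      2 * π * b n := by
  rw [integral_circleMap_div_pow hr (hc.differentiableOn_cexp_logGen.mono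
    (Metric.closedBall_subset_ball hr1)), hc.iteratedDeriv_cexp_logGen hb,
    mul_div_cancel_left₀ _ (Nat.cast_ne_zero.2 n.factorial_ne_zero)]

theorem hasSum_expCoeff_mul_pow (hc : IsAdmissible c σ) {b : ℕ → ℝ} (hb : IsExpCoeff c b)
    (hω : 0 < ω) :
    HasSum (fun n => b n * Real.exp (-1 / ω) ^ n) (Real.exp (moment c 0 ω)) := by
  have hball : ((Real.exp (-1 / ω) : ℝ) : ℂ) ∈ Metric.ball 0 1 := by
    rw [mem_ball_zero_iff, Complex.norm_of_nonneg (Real.exp_pos _).le]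
    exact exp_neg_one_div_lt_one hω
  have htaylor := Complex.hasSum_taylorSeries_on_ball hc.differentiableOn_cexp_logGen hball
  simp only [logGen_exp_eq_moment, hc.iteratedDeriv_cexp_logGen hb, sub_zero, smul_eq_mul]
    at htaylor
  rw [← Complex.hasSum_ofReal, Complex.ofReal_exp]
  refine htaylor.congr_fun fun n => ?_
  have hfactorial : (n.factorial : ℂ) ≠ 0 := Nat.cast_ne_zero.2 n.factorial_ne_zero
  push_cast
  field_simp

theorem expCoeff_le (hc : IsAdmissible c σ) {b : ℕ → ℝ} (hb : IsExpCoeff c b) (hb0 : ∀ n, 0 ≤ b n)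
    (hω : 0 < ω) (n : ℕ) : b n ≤ Real.exp (moment c 0 ω + n / ω) := by
  have hle : b n * Real.exp (-1 / ω) ^ n ≤ Real.exp (moment c 0 ω) :=
    le_hasSum (hc.hasSum_expCoeff_mul_pow hb hω) n fun m _ => mul_nonneg (hb0 m) (by positivity)
  rw [← Real.exp_nat_mul, ← le_div_iff₀ (Real.exp_pos _), ← Real.exp_sub] at hle
  rwa [show moment c 0 ω + n / ω = moment c 0 ω - n * (-1 / ω) by ring]

end IsAdmissible

/-! ### The phase on the saddle-point circle -/

theorem norm_exp_mul_I_sub_le (x : ℝ) :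
    ‖Complex.exp (x * Complex.I) - 1 - x * Complex.I + (x : ℂ) ^ 2 / 2‖ ≤ 4 * |x| ^ 3 := by
  rcases le_total |x| 1 with hx | hx
  · have hnorm : ‖(x : ℂ) * Complex.I‖ = |x| := by simp
    have htaylor : ∑ m ∈ Finset.range 3, ((x : ℂ) * Complex.I) ^ m / (m.factorial : ℂ) =
        1 + x * Complex.I - (x : ℂ) ^ 2 / 2 := by
      simp only [Finset.sum_range_succ, Finset.sum_range_zero, Nat.factorial, mul_pow,
        Complex.I_sq]
      push_cast
      ring
    have hbound := Complex.exp_bound (hnorm.trans_le hx) (n := 3) (by norm_num)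
    rw [hnorm, htaylor, ← sub_add, ← sub_sub] at hbound
    refine hbound.trans ?_
    rw [mul_comm]
    gcongr
    norm_num [Nat.factorial]
  · have htriangle : ‖Complex.exp (x * Complex.I) - 1 - x * Complex.I + (x : ℂ) ^ 2 / 2‖ ≤
        1 + 1 + |x| + |x| ^ 2 / 2 := by
      refine (norm_add_le _ _).trans (add_le_add ((norm_sub_le _ _).trans
        (add_le_add ((norm_sub_le _ _).trans (add_le_add ?_ ?_)) ?_)) ?_)
      · rw [Complex.norm_exp_ofReal_mul_I]
      all_goals simp
    have hone : |x| ≤ |x| ^ 3 := le_self_pow₀ hx (by norm_num)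
    have htwo : |x| ^ 2 ≤ |x| ^ 3 := pow_le_pow_right₀ hx (by norm_num)
    linarith

theorem inv_one_sub_mul_exp_re_sub_inv {r : ℝ} (hr₀ : 0 ≤ r) (hr₁ : r < 1) (θ : ℝ) :
    (1 - r * Complex.exp (θ * Complex.I))⁻¹.re - (1 - r)⁻¹ =
      -(r * (1 + r) * (1 - Real.cos θ) /
        ((1 - r) * ((1 - r) ^ 2 + 2 * r * (1 - Real.cos θ)))) := by
  have hcos := Real.cos_le_one θ
  have hnormSq : Complex.normSq (1 - r * Complex.exp (θ * Complex.I)) =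
      (1 - r) ^ 2 + 2 * r * (1 - Real.cos θ) := by
    simp only [Complex.normSq_apply, Complex.sub_re, Complex.sub_im, Complex.re_ofReal_mul,
      Complex.im_ofReal_mul, Complex.exp_ofReal_mul_I_re, Complex.exp_ofReal_mul_I_im,
      Complex.one_re, Complex.one_im]
    linear_combination r ^ 2 * Real.sin_sq_add_cos_sq θ
  have hsub : 0 < 1 - r := by linarith
  have hden : 0 < (1 - r) ^ 2 + 2 * r * (1 - Real.cos θ) :=
    add_pos_of_pos_of_nonneg (by positivity) (mul_nonneg (by positivity) (by linarith))
  rw [Complex.inv_re, hnormSq, Complex.sub_re, Complex.one_re, Complex.re_ofReal_mul,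
    Complex.exp_ofReal_mul_I_re, inv_eq_one_div, div_sub_div _ _ hden.ne' hsub.ne', ← neg_div,
    div_eq_div_iff (by positivity) (by positivity)]
  ring

theorem hasSum_pow_mul_cos_sub_one {r : ℝ} (hr₀ : 0 ≤ r) (hr₁ : r < 1) (θ : ℝ) :
    HasSum (fun k : ℕ => r ^ k * (Real.cos (k * θ) - 1))
      (-(r * (1 + r) * (1 - Real.cos θ) /
        ((1 - r) * ((1 - r) ^ 2 + 2 * r * (1 - Real.cos θ))))) := by
  have hnorm : ‖(r : ℂ) * Complex.exp (θ * Complex.I)‖ < 1 := by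
    rwa [norm_mul, Complex.norm_exp_ofReal_mul_I, mul_one, Complex.norm_of_nonneg hr₀]
  have hre := Complex.hasSum_re (hasSum_geometric_of_norm_lt_one hnorm)
  rw [← inv_one_sub_mul_exp_re_sub_inv hr₀ hr₁]
  refine (hre.sub (hasSum_geometric_of_lt_one hr₀ hr₁)).congr_fun fun k => ?_
  rw [mul_pow, ← Complex.exp_nat_mul, ← mul_assoc, ← Complex.ofReal_natCast, ← Complex.ofReal_mul,
    ← Complex.ofReal_pow, Complex.re_ofReal_mul, Complex.exp_ofReal_mul_I_re]
  ring

theorem one_third_le_exp_neg_one_div {ω : ℝ} (hω : 1 ≤ ω) : 1 / 3 ≤ Real.exp (-1 / ω) := by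
  have hω0 : 0 < ω := by linarith
  calc (1 : ℝ) / 3 ≤ (Real.exp 1)⁻¹ := by
        rw [one_div]
        exact inv_anti₀ (Real.exp_pos 1) (by linarith [Real.exp_one_lt_d9])
    _ = Real.exp (-1) := (Real.exp_neg 1).symm
    _ ≤ Real.exp (-1 / ω) := by
        rw [Real.exp_le_exp, le_div_iff₀ hω0]
        linarith

theorem mul_one_sub_exp_neg_one_div_le {ω : ℝ} (hω : 0 < ω) :
    ω * (1 - Real.exp (-1 / ω)) ≤ 1 := by
  have hexp := Real.add_one_le_exp (-1 / ω)
  calc ω * (1 - Real.exp (-1 / ω)) ≤ ω * (-(-1 / ω)) := by gcongr; linarith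
    _ = 1 := by field_simp

theorem norm_circleMap_exp_lt_one {ω : ℝ} (hω : 0 < ω) (θ : ℝ) :
    ‖circleMap 0 (Real.exp (-1 / ω)) θ‖ < 1 := by
  rw [norm_circleMap_zero, abs_of_pos (Real.exp_pos _)]
  exact exp_neg_one_div_lt_one hω

theorem sq_div_five_le_one_sub_cos {θ : ℝ} (hθ : |θ| ≤ π) : θ ^ 2 / 5 ≤ 1 - Real.cos θ := by
  have hcos := Real.cos_le_one_sub_mul_cos_sq hθ
  have hπ : (1 : ℝ) / 5 ≤ 2 / π ^ 2 := by
    rw [div_le_div_iff₀ (by norm_num) (by positivity)]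
    nlinarith [Real.pi_lt_d2, Real.pi_pos]
  linarith [mul_le_mul_of_nonneg_right hπ (sq_nonneg θ)]

theorem momentTerm_eq_pow_mul (c : ℕ → ℝ) (j : ℕ) (ω : ℝ) (k : ℕ) :
    momentTerm c j ω k = (k : ℝ) ^ j * momentTerm c 0 ω k := by
  simp only [momentTerm, pow_zero, mul_one]
  ring

theorem logGen_term_circleMap (c : ℕ → ℝ) (ω θ : ℝ) (k : ℕ) :
    (c k : ℂ) * circleMap 0 (Real.exp (-1 / ω)) θ ^ k =
      momentTerm c 0 ω k * Complex.exp ((k * θ : ℝ) * Complex.I) := by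
  rw [circleMap_zero, mul_pow, ← Complex.ofReal_pow, ← Real.exp_nat_mul, ← Complex.exp_nat_mul,
    momentTerm, pow_zero, mul_one, mul_div_assoc', mul_neg_one]
  push_cast
  ring_nf

/-- The logarithm of the integrand of the Cauchy integral for the `n`-th coefficient at angle `θ` of
the circle of radius `e ^ (-1 / ω)`, normalized to vanish at `θ = 0`, where `n = moment c 1 ω`. -/
noncomputable def phase (c : ℕ → ℝ) (ω θ : ℝ) : ℂ :=
  logGen c (circleMap 0 (Real.exp (-1 / ω)) θ) - moment c 0 ω - θ * moment c 1 ω * Complex.I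

namespace IsAdmissible

variable {c : ℕ → ℝ} {σ : ℝ} {ω : ℝ}

theorem continuous_phase (hc : IsAdmissible c σ) (hω : 0 < ω) : Continuous (phase c ω) := by
  have hlogGen : Continuous fun θ => logGen c (circleMap 0 (Real.exp (-1 / ω)) θ) :=
    continuous_iff_continuousAt.2 fun θ =>
      (hc.analyticAt_logGen (norm_circleMap_exp_lt_one hω θ)).continuousAt.comp
        (continuous_circleMap 0 _).continuousAt
  unfold phase
  fun_prop

theorem hasSum_moment (hc : IsAdmissible c σ) (j : ℕ) (hω : 0 < ω) :
    HasSum (fun k : ℕ => (k : ℝ) ^ j * momentTerm c 0 ω k) (moment c j ω) := by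
  simp only [← momentTerm_eq_pow_mul]
  exact (hc.summable_momentTerm j hω).hasSum

theorem hasSum_phase (hc : IsAdmissible c σ) (hω : 0 < ω) (θ : ℝ) :
    HasSum (fun k : ℕ => (momentTerm c 0 ω k : ℂ) *
      (Complex.exp ((k * θ : ℝ) * Complex.I) - 1 - (k * θ : ℝ) * Complex.I)) (phase c ω θ) := by
  have hlogGen : HasSum (fun k => (c k : ℂ) * circleMap 0 (Real.exp (-1 / ω)) θ ^ k)
      (logGen c (circleMap 0 (Real.exp (-1 / ω)) θ)) :=
    (hc.summable_norm_logGen (norm_circleMap_exp_lt_one hω θ)).of_norm.hasSum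
  have hzero := Complex.hasSum_ofReal.2 (hc.hasSum_moment 0 hω)
  have hone := ((Complex.hasSum_ofReal.2 (hc.hasSum_moment 1 hω)).mul_left (θ : ℂ)).mul_right
    Complex.I
  refine ((hlogGen.sub hzero).sub hone).congr_fun fun k => ?_
  rw [logGen_term_circleMap]
  push_cast
  ring

theorem hasSum_re_phase (hc : IsAdmissible c σ) (hω : 0 < ω) (θ : ℝ) :
    HasSum (fun k : ℕ => momentTerm c 0 ω k * (Real.cos (k * θ) - 1)) (phase c ω θ).re := by
  refine (Complex.hasSum_re (hc.hasSum_phase hω θ)).congr_fun fun k => ?_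
  rw [Complex.re_ofReal_mul, Complex.sub_re, Complex.sub_re, Complex.exp_ofReal_mul_I_re,
    Complex.one_re, Complex.re_ofReal_mul, Complex.I_re, mul_zero, sub_zero]

theorem norm_phase_add_le (hc : IsAdmissible c σ) (hω : 0 < ω) (θ : ℝ) :
    ‖phase c ω θ + moment c 2 ω * (θ : ℂ) ^ 2 / 2‖ ≤ 4 * moment c 3 ω * |θ| ^ 3 := by
  have htwo := (Complex.hasSum_ofReal.2 (hc.hasSum_moment 2 hω)).mul_right ((θ : ℂ) ^ 2 / 2)
  have hthree := (hc.hasSum_moment 3 hω).mul_left (4 * |θ| ^ 3)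
  rw [mul_div_assoc, ← ((hc.hasSum_phase hω θ).add htwo).tsum_eq, mul_right_comm]
  refine tsum_of_norm_bounded hthree fun k => ?_
  have hfactor : (momentTerm c 0 ω k : ℂ) *
        (Complex.exp ((k * θ : ℝ) * Complex.I) - 1 - (k * θ : ℝ) * Complex.I) +
        ((k : ℝ) ^ 2 * momentTerm c 0 ω k : ℝ) * ((θ : ℂ) ^ 2 / 2) =
      momentTerm c 0 ω k * (Complex.exp ((k * θ : ℝ) * Complex.I) - 1 - (k * θ : ℝ) * Complex.I +
        ((k * θ : ℝ) : ℂ) ^ 2 / 2) := by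
    push_cast
    ring
  have hnonneg := hc.momentTerm_nonneg 0 ω k
  rw [hfactor, norm_mul, Complex.norm_of_nonneg hnonneg]
  calc _ ≤ momentTerm c 0 ω k * (4 * |k * θ| ^ 3) := by
        gcongr
        exact norm_exp_mul_I_sub_le _
    _ = _ := by
        rw [abs_mul, Nat.abs_cast]
        ring

theorem exp_pow_le_momentTerm (hc : IsAdmissible c σ) {k : ℕ} (hk : k ≠ 0) (ω : ℝ) :
    Real.exp (-1 / ω) ^ k ≤ momentTerm c 0 ω k := by
  rw [momentTerm, pow_zero, mul_one, ← Real.exp_nat_mul, mul_div_assoc', mul_neg_one]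
  exact le_mul_of_one_le_left (Real.exp_pos _).le (hc.one_le k hk)

-- All terms of the series for `Re (phase c ω θ)` are nonpositive and `1 ≤ c k`, so the series is
-- bounded above by its analogue for `c = 1`, which has a closed form.
theorem re_phase_le_geometric (hc : IsAdmissible c σ) (hω : 0 < ω) (θ : ℝ) :
    (phase c ω θ).re ≤ -(Real.exp (-1 / ω) * (1 + Real.exp (-1 / ω)) * (1 - Real.cos θ) /
      ((1 - Real.exp (-1 / ω)) *
        ((1 - Real.exp (-1 / ω)) ^ 2 + 2 * Real.exp (-1 / ω) * (1 - Real.cos θ)))) := by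
  refine hasSum_le (fun k => ?_) (hc.hasSum_re_phase hω θ)
    (hasSum_pow_mul_cos_sub_one (Real.exp_pos _).le (exp_neg_one_div_lt_one hω) θ)
  rcases eq_or_ne k 0 with rfl | hk
  · simp
  · exact mul_le_mul_of_nonpos_right (hc.exp_pow_le_momentTerm hk ω)
      (sub_nonpos.2 (Real.cos_le_one _))

theorem re_phase_le_neg_mul_cube (hc : IsAdmissible c σ) {θ y : ℝ} (hω : 1 ≤ ω) (hy : 0 ≤ y)
    (hyω : y * ω ^ 2 ≤ 1) (hyθ : y ≤ 1 - Real.cos θ) :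
    (phase c ω θ).re ≤ -(y * ω ^ 3 / 9) := by
  have hω0 : 0 < ω := by linarith
  refine (hc.re_phase_le_geometric hω0 θ).trans (neg_le_neg ?_)
  have hr₁ := exp_neg_one_div_lt_one hω0
  have hr₃ := one_third_le_exp_neg_one_div hω
  have hωr := mul_one_sub_exp_neg_one_div_le hω0
  set r := Real.exp (-1 / ω)
  set Y := 1 - Real.cos θ
  have hY : 0 ≤ Y := hy.trans hyθ
  have : 0 < 1 - r := by linarith
  have hfirst : y * (ω * (1 - r)) ^ 2 ≤ Y := by
    calc y * (ω * (1 - r)) ^ 2 ≤ y * 1 := by gcongr; exact pow_le_one₀ (by positivity) hωr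
      _ ≤ Y := by rwa [mul_one]
  have hsecond : 2 * r * Y * (y * ω ^ 2) ≤ 2 * r * Y :=
    mul_le_of_le_one_right (by positivity) hyω
  rw [div_le_div_iff₀ (by norm_num) (by positivity)]
  calc y * ω ^ 3 * ((1 - r) * ((1 - r) ^ 2 + 2 * r * Y))
      = ω * (1 - r) * (y * (ω * (1 - r)) ^ 2 + 2 * r * Y * (y * ω ^ 2)) := by ring
    _ ≤ 1 * (Y + 2 * r * Y) := by gcongr
    _ = (1 + 2 * r) * Y := by ring
    _ ≤ (r * (1 + r) * 9) * Y := by gcongr; nlinarith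
    _ = r * (1 + r) * Y * 9 := by ring

theorem re_phase_le_of_mul_abs_le (hc : IsAdmissible c σ) {θ : ℝ} (hω : 0 < ω)
    (hθ : 16 * moment c 3 ω * |θ| ≤ moment c 2 ω) :
    (phase c ω θ).re ≤ -(moment c 2 ω * θ ^ 2 / 4) := by
  have hre := (Complex.re_le_norm _).trans (hc.norm_phase_add_le hω θ)
  have hcast : moment c 2 ω * (θ : ℂ) ^ 2 / 2 = ((moment c 2 ω * θ ^ 2 / 2 : ℝ) : ℂ) := by
    push_cast
    ring
  rw [hcast, Complex.add_re, Complex.ofReal_re] at hre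
  have hcubic : 4 * moment c 3 ω * |θ| ^ 3 ≤ moment c 2 ω * θ ^ 2 / 4 := by
    calc 4 * moment c 3 ω * |θ| ^ 3 = 16 * moment c 3 ω * |θ| * |θ| ^ 2 / 4 := by ring
      _ ≤ moment c 2 ω * |θ| ^ 2 / 4 := by gcongr
      _ = _ := by rw [sq_abs]
  linarith

theorem exists_mul_rpow_le_abs (hc : IsAdmissible c σ) :
    ∃ δ > 0, ∀ ω θ : ℝ, 1 ≤ ω → moment c 2 ω ≤ 16 * moment c 3 ω * |θ| →
      δ * ω ^ (-σ) ≤ |θ| := by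
  obtain ⟨C, hC, hle⟩ := hc.exists_moment_le 3
  refine ⟨Real.exp (-4) / (16 * C), by positivity, fun ω θ hω hθ => ?_⟩
  have hω0 : 0 < ω := by linarith
  have hchain : Real.exp (-4) * ω ^ 3 ≤ 16 * (C * (ω ^ 3 * ω ^ σ)) * |θ| := by
    calc Real.exp (-4) * ω ^ 3 ≤ 16 * moment c 3 ω * |θ| := (hc.le_moment 2 hω).trans hθ
      _ ≤ 16 * (C * ω ^ ((3 : ℕ) + σ)) * |θ| := by gcongr; exact hle ω hω0
      _ = _ := by rw [Real.rpow_add hω0, Real.rpow_natCast]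
  rw [Real.rpow_neg hω0.le, ← div_eq_mul_inv, div_div, div_le_iff₀ (by positivity)]
  refine le_of_mul_le_mul_right ?_ (pow_pos hω0 3)
  linarith

theorem exists_re_phase_le_of_le_mul_abs (hc : IsAdmissible c σ) :
    ∃ κ > 0, ∀ ω θ : ℝ, 1 ≤ ω → |θ| ≤ π → moment c 2 ω ≤ 16 * moment c 3 ω * |θ| →
      (phase c ω θ).re ≤ -κ * ω ^ (3 - 2 * σ) := by
  obtain ⟨δ, hδ, hδle⟩ := hc.exists_mul_rpow_le_abs
  set ε := min δ 1
  have hε : 0 < ε := lt_min hδ one_pos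
  have hε1 : ε ^ 2 ≤ 1 := pow_le_one₀ hε.le (min_le_right _ _)
  refine ⟨ε ^ 2 / 45, by positivity, fun ω θ hω hθ hmoment => ?_⟩
  have hω0 : 0 < ω := by linarith
  have hpow : ∀ m : ℕ, (ω ^ (-σ)) ^ 2 * ω ^ m = ω ^ (m - 2 * σ) := fun m => by
    rw [← Real.rpow_mul_natCast hω0.le, ← Real.rpow_natCast ω m, ← Real.rpow_add hω0]
    congr 1
    push_cast
    ring
  have hθlow : ε * ω ^ (-σ) ≤ |θ| :=
    (mul_le_mul_of_nonneg_right (min_le_left _ _) (by positivity)).trans (hδle ω θ hω hmoment)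
  have hcos : (ε * ω ^ (-σ)) ^ 2 / 5 ≤ 1 - Real.cos θ := by
    refine le_trans ?_ (sq_div_five_le_one_sub_cos hθ)
    rw [← sq_abs θ]
    gcongr
  have hle_one : (ε * ω ^ (-σ)) ^ 2 / 5 * ω ^ 2 ≤ 1 := by
    have hrpow : ω ^ ((2 : ℕ) - 2 * σ) ≤ 1 :=
      Real.rpow_le_one_of_one_le_of_nonpos hω (by push_cast; linarith [hc.one_lt])
    calc (ε * ω ^ (-σ)) ^ 2 / 5 * ω ^ 2 = ε ^ 2 / 5 * ω ^ ((2 : ℕ) - 2 * σ) := by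
          rw [← hpow]; ring
      _ ≤ 1 := mul_le_one₀ (by linarith) (by positivity) hrpow
  refine (hc.re_phase_le_neg_mul_cube hω (by positivity) hle_one hcos).trans_eq ?_
  have hpow3 := hpow 3
  push_cast at hpow3
  rw [← hpow3]
  ring

end IsAdmissible

/-! ### The saddle-point integral -/

theorem tendsto_smul_integral_of_dominated {ι E : Type*} [NormedAddCommGroup E] [NormedSpace ℝ E]
    {l : Filter ι} [l.IsCountablyGenerated] {s : ι → ℝ} {f : ι → ℝ → E} {F : ℝ → E}
    {bound : ℝ → ℝ} {a : ℝ} (ha : 0 < a) (hs : Tendsto s l atTop)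
    (hf : ∀ᶠ i in l, Continuous (f i)) (hbound_nonneg : ∀ u, 0 ≤ bound u)
    (hbound : ∀ᶠ i in l, ∀ u, |u| ≤ a * s i → ‖f i (u / s i)‖ ≤ bound u)
    (hint : MeasureTheory.Integrable bound)
    (hlim : ∀ u, Tendsto (fun i => f i (u / s i)) l (𝓝 (F u))) :
    Tendsto (fun i => s i • ∫ θ in (-a)..a, f i θ) l (𝓝 (∫ u, F u)) := by
  have hdominated : Tendsto (fun i => ∫ u, (Set.Ioc (-(a * s i)) (a * s i)).indicator
      (fun u => f i (u / s i)) u) l (𝓝 (∫ u, F u)) := by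
    refine MeasureTheory.tendsto_integral_filter_of_dominated_convergence bound ?_ ?_ hint ?_
    · filter_upwards [hf] with i hfi
      exact (hfi.comp (continuous_id.div_const _)).aestronglyMeasurable.indicator measurableSet_Ioc
    · filter_upwards [hbound] with i hi
      refine .of_forall fun u => ?_
      rw [norm_indicator_eq_indicator_norm]
      exact Set.indicator_le' (fun u hu => hi u (abs_le.2 ⟨hu.1.le, hu.2⟩))
        (fun u _ => hbound_nonneg u) u
    · refine .of_forall fun u => (hlim u).congr' ?_
      filter_upwards [(hs.const_mul_atTop ha).eventually_gt_atTop |u|] with i hu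
      rw [Set.indicator_of_mem]
      exact ⟨(abs_lt.1 hu).1, (abs_lt.1 hu).2.le⟩
  refine hdominated.congr' ?_
  filter_upwards [hs.eventually_gt_atTop 0] with i hi
  have hrescale := intervalIntegral.integral_comp_div (a := -(a * s i)) (b := a * s i) (f i) hi.ne'
  rw [neg_div, mul_div_cancel_right₀ _ hi.ne'] at hrescale
  rw [MeasureTheory.integral_indicator measurableSet_Ioc, ← hrescale,
    intervalIntegral.integral_of_le (neg_le_self (by positivity))]

theorem tendsto_rpow_mul_exp_neg_mul_rpow {κ a : ℝ} (hκ : 0 < κ) (ha : 0 < a) (b : ℝ) :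
    Tendsto (fun ω : ℝ => ω ^ b * Real.exp (-κ * ω ^ a)) atTop (𝓝 0) := by
  refine ((tendsto_rpow_mul_exp_neg_mul_atTop_nhds_zero (b / a) κ hκ).comp
    (tendsto_rpow_atTop ha)).congr' ?_
  filter_upwards [eventually_gt_atTop 0] with ω hω
  rw [Function.comp_apply, ← Real.rpow_mul hω.le, mul_div_cancel₀ _ ha.ne']

theorem integral_cexp_neg_sq_div_two :
    ∫ u : ℝ, Complex.exp (-(u : ℂ) ^ 2 / 2) = (√(2 * π) : ℂ) := by
  have hgauss := integral_gaussian (1 / 2)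
  rw [show π / (1 / 2) = 2 * π by ring] at hgauss
  rw [← hgauss, ← integral_complex_ofReal]
  refine MeasureTheory.integral_congr_ae (.of_forall fun u => ?_)
  push_cast
  ring_nf

namespace IsAdmissible

variable {c : ℕ → ℝ} {σ : ℝ}

theorem tendsto_moment_three_div (hc : IsAdmissible c σ) :
    Tendsto (fun ω : ℝ => moment c 3 ω / √(moment c 2 ω) ^ 3) atTop (𝓝 0) := by
  obtain ⟨C, hC, hle⟩ := hc.exists_moment_le 3
  have hlim : Tendsto (fun ω : ℝ => C * Real.exp 6 * ω ^ (-(3 / 2 - σ))) atTop (𝓝 0) := by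
    simpa using (tendsto_rpow_neg_atTop (sub_pos.2 hc.lt)).const_mul (C * Real.exp 6)
  refine squeeze_zero' ?_ ?_ hlim
  · filter_upwards [eventually_ge_atTop 1] with ω hω
    have := hc.moment_pos 3 hω
    positivity
  · filter_upwards [eventually_ge_atTop 1] with ω hω
    have hω0 : 0 < ω := by linarith
    have hsqrt : √(Real.exp (-4) * ω ^ 3) ^ 3 = Real.exp (-6) * ω ^ (9 / 2 : ℝ) := by
      rw [Real.sqrt_eq_rpow, ← Real.rpow_mul_natCast (by positivity),
        Real.mul_rpow (by positivity) (by positivity), ← Real.exp_mul,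
        ← Real.rpow_natCast_mul hω0.le]
      norm_num
    calc moment c 3 ω / √(moment c 2 ω) ^ 3
        ≤ C * ω ^ ((3 : ℕ) + σ) / √(Real.exp (-4) * ω ^ 3) ^ 3 := by
          gcongr
          exacts [hle ω hω0, hc.le_moment 2 hω]
      _ = C * (Real.exp (-6))⁻¹ * (ω ^ ((3 : ℕ) + σ) / ω ^ (9 / 2 : ℝ)) := by
          rw [hsqrt]
          field_simp
      _ = C * Real.exp 6 * ω ^ (-(3 / 2 - σ)) := by
          rw [← Real.exp_neg, neg_neg, ← Real.rpow_sub hω0]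
          congr 2
          push_cast
          ring

theorem tendsto_phase_rescaled (hc : IsAdmissible c σ) (u : ℝ) :
    Tendsto (fun ω : ℝ => phase c ω (u / √(moment c 2 ω))) atTop (𝓝 (-(u : ℂ) ^ 2 / 2)) := by
  rw [tendsto_iff_norm_sub_tendsto_zero]
  have hlim : Tendsto (fun ω : ℝ => 4 * |u| ^ 3 * (moment c 3 ω / √(moment c 2 ω) ^ 3)) atTop
      (𝓝 0) := by
    simpa using hc.tendsto_moment_three_div.const_mul (4 * |u| ^ 3)
  refine squeeze_zero' (.of_forall fun _ => norm_nonneg _) ?_ hlim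
  filter_upwards [eventually_ge_atTop 1] with ω hω
  have hpos := hc.moment_pos 2 hω
  have hsq : (moment c 2 ω : ℂ) * ((u / √(moment c 2 ω) : ℝ) : ℂ) ^ 2 = (u : ℂ) ^ 2 := by
    rw [← Complex.ofReal_pow, div_pow, Real.sq_sqrt hpos.le, ← Complex.ofReal_mul,
      mul_div_cancel₀ _ hpos.ne', Complex.ofReal_pow]
  have hphase := hc.norm_phase_add_le (zero_lt_one.trans_le hω) (u / √(moment c 2 ω))
  rw [hsq, abs_div, abs_of_nonneg (Real.sqrt_nonneg _), div_pow] at hphase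
  rw [neg_div, sub_neg_eq_add]
  refine hphase.trans_eq ?_
  ring

theorem eventually_exp_le_inv_one_add_sq (hc : IsAdmissible c σ) {κ : ℝ} (hκ : 0 < κ) :
    ∀ᶠ ω : ℝ in atTop, ∀ u : ℝ, |u| ≤ π * √(moment c 2 ω) →
      Real.exp (-κ * ω ^ (3 - 2 * σ)) ≤ (1 + u ^ 2)⁻¹ := by
  obtain ⟨C, -, hle⟩ := hc.exists_moment_le 2
  have ha : 0 < 3 - 2 * σ := by linarith [hc.lt]
  have hlim : Tendsto (fun ω : ℝ => (1 + π ^ 2 * C * ω ^ ((2 : ℕ) + σ)) *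
      Real.exp (-κ * ω ^ (3 - 2 * σ))) atTop (𝓝 0) := by
    have h := (tendsto_rpow_mul_exp_neg_mul_rpow hκ ha 0).add
      ((tendsto_rpow_mul_exp_neg_mul_rpow hκ ha ((2 : ℕ) + σ)).const_mul (π ^ 2 * C))
    simpa only [Real.rpow_zero, ← mul_assoc, ← add_mul, mul_zero, add_zero] using h
  filter_upwards [eventually_ge_atTop 1, hlim.eventually_le_const one_pos] with ω hω hsmall u hu
  have hpos := hc.moment_pos 2 hω
  have husq : u ^ 2 ≤ π ^ 2 * C * ω ^ ((2 : ℕ) + σ) := by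
    calc u ^ 2 = |u| ^ 2 := (sq_abs u).symm
      _ ≤ (π * √(moment c 2 ω)) ^ 2 := by gcongr
      _ = π ^ 2 * moment c 2 ω := by rw [mul_pow, Real.sq_sqrt hpos.le]
      _ ≤ π ^ 2 * (C * ω ^ ((2 : ℕ) + σ)) := by
          gcongr
          exact hle ω (by linarith)
      _ = _ := by ring
  rw [← one_div, le_div_iff₀ (by positivity), mul_comm]
  refine le_trans ?_ hsmall
  gcongr

-- The two summands dominate the integrand near the saddle point and away from it.
theorem eventually_norm_cexp_phase_le (hc : IsAdmissible c σ) :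
    ∀ᶠ ω : ℝ in atTop, ∀ u : ℝ, |u| ≤ π * √(moment c 2 ω) →
      ‖Complex.exp (phase c ω (u / √(moment c 2 ω)))‖ ≤
        Real.exp (-(1 / 4) * u ^ 2) + (1 + u ^ 2)⁻¹ := by
  obtain ⟨κ, hκ, hfar⟩ := hc.exists_re_phase_le_of_le_mul_abs
  filter_upwards [eventually_ge_atTop 1, hc.eventually_exp_le_inv_one_add_sq hκ] with ω hω hexp u hu
  have hpos := hc.moment_pos 2 hω
  have hsqrt : 0 < √(moment c 2 ω) := Real.sqrt_pos.2 hpos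
  rw [Complex.norm_exp]
  set θ := u / √(moment c 2 ω) with hθ
  rcases le_total (16 * moment c 3 ω * |θ|) (moment c 2 ω) with hnear | hnotNear
  · have hsq : moment c 2 ω * θ ^ 2 = u ^ 2 := by
      rw [hθ, div_pow, Real.sq_sqrt hpos.le, mul_div_cancel₀ _ hpos.ne']
    refine le_add_of_le_of_nonneg (Real.exp_le_exp.2 ?_) (by positivity)
    linarith [hc.re_phase_le_of_mul_abs_le (by linarith) hnear]
  · have hθπ : |θ| ≤ π := by rwa [hθ, abs_div, abs_of_pos hsqrt, div_le_iff₀ hsqrt]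
    refine le_add_of_nonneg_of_le (Real.exp_pos _).le (le_trans ?_ (hexp u hu))
    exact Real.exp_le_exp.2 (hfar ω θ hω hθπ hnotNear)

theorem tendsto_sqrt_smul_integral_cexp_phase (hc : IsAdmissible c σ) :
    Tendsto (fun ω : ℝ => √(moment c 2 ω) • ∫ θ in (-π)..π, Complex.exp (phase c ω θ)) atTop
      (𝓝 (√(2 * π) : ℂ)) := by
  rw [← integral_cexp_neg_sq_div_two]
  refine tendsto_smul_integral_of_dominated Real.pi_pos
    (Real.tendsto_sqrt_atTop.comp (hc.tendsto_moment_atTop 2)) ?_ (fun u => by positivity)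
    hc.eventually_norm_cexp_phase_le
    ((integrable_exp_neg_mul_sq (by norm_num)).add integrable_inv_one_add_sq)
    fun u => (Complex.continuous_exp.tendsto _).comp (hc.tendsto_phase_rescaled u)
  filter_upwards [eventually_gt_atTop 0] with ω hω
  exact Complex.continuous_exp.comp (hc.continuous_phase hω)

end IsAdmissible

/-! ### The saddle-point approximation -/

/-- The saddle-point approximation to the `n`-th coefficient of `exp (∑ c k z ^ k)`, where `ω` is
meant to solve `moment c 1 ω = n`. -/
noncomputable def saddleApprox (c : ℕ → ℝ) (n : ℕ) (ω : ℝ) : ℝ :=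
  1 / √(2 * π * moment c 2 ω) * Real.exp (moment c 0 ω + n / ω)

theorem cexp_logGen_div_circleMap_pow {c : ℕ → ℝ} {n : ℕ} {ω : ℝ} (hn : moment c 1 ω = n) (θ : ℝ) :
    Complex.exp (logGen c (circleMap 0 (Real.exp (-1 / ω)) θ)) /
        circleMap 0 (Real.exp (-1 / ω)) θ ^ n =
      Real.exp (moment c 0 ω + n / ω) * Complex.exp (phase c ω θ) := by
  rw [div_eq_iff (pow_ne_zero _ (circleMap_ne_center (Real.exp_pos _).ne')), phase, hn]
  generalize logGen c _ = L
  rw [circleMap_zero, mul_pow, Complex.ofReal_exp, Complex.ofReal_exp, ← Complex.exp_nat_mul,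
    ← Complex.exp_nat_mul, ← Complex.exp_add, ← Complex.exp_add, ← Complex.exp_add]
  push_cast
  ring_nf

namespace IsAdmissible

variable {c b : ℕ → ℝ} {σ : ℝ}

theorem saddleApprox_pos (hc : IsAdmissible c σ) (n : ℕ) {ω : ℝ} (hω : 1 ≤ ω) :
    0 < saddleApprox c n ω := by
  have := hc.moment_pos 2 hω
  unfold saddleApprox
  positivity

theorem sqrt_smul_integral_cexp_phase (hc : IsAdmissible c σ) (hb : IsExpCoeff c b) {n : ℕ} {ω : ℝ}
    (hω : 0 < ω) (hn : moment c 1 ω = n) :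
    √(moment c 2 ω) • ∫ θ in (-π)..π, Complex.exp (phase c ω θ) =
      (√(2 * π) * (b n / saddleApprox c n ω) : ℝ) := by
  have hcauchy := hc.integral_cexp_logGen_div_pow hb (Real.exp_pos _) (exp_neg_one_div_lt_one hω) n
  simp only [cexp_logGen_div_circleMap_pow hn, intervalIntegral.integral_const_mul] at hcauchy
  rw [saddleApprox, Real.sqrt_mul Real.two_pi_pos.le]
  set E := Real.exp (moment c 0 ω + n / ω)
  have hE : (E : ℂ) ≠ 0 := Complex.ofReal_ne_zero.2 (Real.exp_pos _).ne'
  have hreal : √(2 * π) * (b n / (1 / (√(2 * π) * √(moment c 2 ω)) * E)) =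
      √(2 * π) * √(2 * π) * √(moment c 2 ω) * b n / E := by
    field_simp
  rw [mul_comm, ← eq_div_iff hE] at hcauchy
  rw [hcauchy, hreal, Real.mul_self_sqrt Real.two_pi_pos.le, Complex.real_smul]
  push_cast
  ring

theorem tendsto_saddlePoint (hc : IsAdmissible c σ) {ω : ℕ → ℝ}
    (hω : ∀ n : ℕ, 1 ≤ n → 0 < ω n ∧ moment c 1 (ω n) = n) : Tendsto ω atTop atTop := by
  refine hc.tendsto_atTop_of_tendsto_moment (j := 1) ?_ (tendsto_natCast_atTop_atTop.congr' ?_)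
  · filter_upwards [eventually_ge_atTop 1] with n hn using (hω n hn).1
  · filter_upwards [eventually_ge_atTop 1] with n hn using (hω n hn).2.symm

theorem tendsto_expCoeff_div_saddleApprox (hc : IsAdmissible c σ) (hb : IsExpCoeff c b) {ω : ℕ → ℝ}
    (hω : ∀ n : ℕ, 1 ≤ n → 0 < ω n ∧ moment c 1 (ω n) = n) :
    Tendsto (fun n => b n / saddleApprox c n (ω n)) atTop (𝓝 1) := by
  have hsqrt : √(2 * π) ≠ 0 := by positivity
  have hlaplace : Tendsto (fun n => √(2 * π) * (b n / saddleApprox c n (ω n))) atTop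
      (𝓝 √(2 * π)) := by
    rw [← tendsto_ofReal_iff]
    refine (hc.tendsto_sqrt_smul_integral_cexp_phase.comp (hc.tendsto_saddlePoint hω)).congr' ?_
    filter_upwards [eventually_ge_atTop 1] with n hn
    exact hc.sqrt_smul_integral_cexp_phase hb (hω n hn).1 (hω n hn).2
  simpa only [mul_div_cancel_left₀ _ hsqrt, div_self hsqrt] using hlaplace.div_const √(2 * π)

theorem tendsto_moment_one_mul_sqrt_mul_exp (hc : IsAdmissible c σ) :
    Tendsto (fun ω : ℝ => moment c 1 ω * √(2 * π * moment c 2 ω) *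
      Real.exp (-(moment c 1 ω / (2 * ω)))) atTop (𝓝 0) := by
  obtain ⟨C₁, hC₁, hle₁⟩ := hc.exists_moment_le 1
  obtain ⟨C₂, hC₂, hle₂⟩ := hc.exists_moment_le 2
  set a₁ : ℝ := (1 : ℕ) + σ
  set a₂ : ℝ := (2 : ℕ) + σ
  have hlim := (tendsto_rpow_mul_exp_neg_mul_rpow (κ := Real.exp (-4) / 2) (by positivity) one_pos
    (a₁ + a₂ / 2)).const_mul (C₁ * √(2 * π * C₂))
  rw [mul_zero] at hlim
  refine squeeze_zero' ?_ ?_ hlim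
  · filter_upwards [eventually_ge_atTop 1] with ω hω
    have := hc.moment_pos 1 hω
    positivity
  · filter_upwards [eventually_ge_atTop 1] with ω hω
    have hω0 : 0 < ω := by linarith
    have hexponent : Real.exp (-4) / 2 * ω ≤ moment c 1 ω / (2 * ω) := by
      rw [le_div_iff₀ (by positivity)]
      calc Real.exp (-4) / 2 * ω * (2 * ω) = Real.exp (-4) * ω ^ (1 + 1) := by ring
        _ ≤ moment c 1 ω := hc.le_moment 1 hω
    have hsqrt : √(2 * π * (C₂ * ω ^ a₂)) = √(2 * π * C₂) * ω ^ (a₂ / 2) := by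
      rw [← mul_assoc, Real.sqrt_mul (by positivity), Real.sqrt_eq_rpow (ω ^ a₂),
        ← Real.rpow_mul hω0.le, mul_one_div]
    calc moment c 1 ω * √(2 * π * moment c 2 ω) * Real.exp (-(moment c 1 ω / (2 * ω)))
        ≤ C₁ * ω ^ a₁ * √(2 * π * (C₂ * ω ^ a₂)) * Real.exp (-(Real.exp (-4) / 2 * ω)) := by
          gcongr
          exacts [hle₁ ω hω0, hle₂ ω hω0]
      _ = C₁ * √(2 * π * C₂) *
          (ω ^ (a₁ + a₂ / 2) * Real.exp (-(Real.exp (-4) / 2) * ω ^ (1 : ℝ))) := by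
          rw [hsqrt, Real.rpow_add hω0 a₁, Real.rpow_one, neg_mul]
          ring

theorem tendsto_mul_exp_half_div_saddleApprox (hc : IsAdmissible c σ) {ω : ℕ → ℝ}
    (hω : ∀ n : ℕ, 1 ≤ n → 0 < ω n ∧ moment c 1 (ω n) = n) :
    Tendsto (fun n : ℕ => n * Real.exp (moment c 0 (ω n) + n / (2 * ω n)) /
      saddleApprox c n (ω n)) atTop (𝓝 0) := by
  have htendsto := hc.tendsto_saddlePoint hω
  refine (hc.tendsto_moment_one_mul_sqrt_mul_exp.comp htendsto).congr' ?_
  filter_upwards [eventually_ge_atTop 1, htendsto.eventually_ge_atTop 1] with n hn hωn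
  have hexp : Real.exp (moment c 0 (ω n) + n / (2 * ω n)) =
      Real.exp (-(n / (2 * ω n))) * Real.exp (moment c 0 (ω n) + n / ω n) := by
    rw [← Real.exp_add]
    congr 1
    ring
  have hsqrt : √(2 * π * moment c 2 (ω n)) ≠ 0 := by
    have := hc.moment_pos 2 hωn
    positivity
  rw [Function.comp_apply, (hω n hn).2, saddleApprox, hexp]
  field_simp

end IsAdmissible

/-! ### Asymptotics of generalized partitions -/

/-- The coefficients of `log (∑ p n z ^ n)`. At `k = 0` the value is `0 / 0 = 0`. -/
noncomputable def logCoeff (k : ℕ) : ℝ := weight k / k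

theorem isAdmissible_logCoeff : IsAdmissible logCoeff (5 / 4) where
  map_zero := by simp [logCoeff]
  one_le k hk := by
    rw [logCoeff, one_le_div (by positivity)]
    exact_mod_cast le_weight k
  summable := by
    refine (summable_weight_mul_rpow (s := 9 / 4) (by norm_num)).congr fun k => ?_
    rcases eq_or_ne k 0 with rfl | hk
    · simp [logCoeff, weight_zero]
    · rw [logCoeff, div_mul_eq_mul_div, mul_div_assoc, ← Real.rpow_sub_one (by positivity)]
      norm_num
  lt := by norm_num

theorem isExpCoeff_p : IsExpCoeff logCoeff (fun n => p n) where
  zero := by rw [p_zero, Nat.cast_one]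
  mul_eq_sum n := by
    have hweight : ∀ k : ℕ, k * logCoeff k = weight k := fun k => by
      rcases eq_or_ne k 0 with rfl | hk
      · simp [weight_zero]
      · rw [logCoeff, mul_div_cancel₀ _ (by positivity)]
    simp only [hweight]
    exact_mod_cast mul_p_eq_sum n

theorem STerm_eq_momentTerm {m : ℤ} {j : ℕ} (hmj : m + 1 = j) (ω : ℝ) :
    STerm m ω = momentTerm logCoeff j ω := by
  funext k
  rcases eq_or_ne k 0 with rfl | hk
  · simp [STerm, momentTerm, logCoeff]
  · have hk' : (k : ℝ) ≠ 0 := Nat.cast_ne_zero.2 hk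
    rw [STerm, ← Finset.sum_mul, ← Finset.sum_mul, momentTerm, logCoeff, weight, ← zpow_natCast,
      ← hmj, zpow_add_one₀ hk']
    push_cast
    field_simp

theorem S_eq_moment {m : ℤ} {j : ℕ} (hmj : m + 1 = j) (ω : ℝ) : S m ω = moment logCoeff j ω := by
  rw [S, moment, STerm_eq_momentTerm hmj]

theorem summable_STerm {m : ℤ} (hm : -1 ≤ m) {ω : ℝ} (hω : 0 < ω) : Summable (STerm m ω) := by
  obtain ⟨j, hj⟩ := Int.eq_ofNat_of_zero_le (by omega : 0 ≤ m + 1)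
  rw [STerm_eq_momentTerm hj]
  exact isAdmissible_logCoeff.summable_momentTerm j hω

theorem p_sub_q_le {n : ℕ} (hn : n ≠ 0) {ω : ℝ} (hω : 0 < ω) :
    (p n : ℝ) - q n ≤ n * Real.exp (moment logCoeff 0 ω + n / (2 * ω)) := by
  have hterm : ∀ d ∈ Finset.Icc 2 n,
      (p (n / d) : ℝ) ≤ Real.exp (moment logCoeff 0 ω + n / (2 * ω)) := by
    intro d hd
    have hd2 : (2 : ℝ) ≤ d := mod_cast (Finset.mem_Icc.1 hd).1
    refine (isAdmissible_logCoeff.expCoeff_le isExpCoeff_p (fun _ => Nat.cast_nonneg _) hω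
      _).trans ?_
    have hdiv : ((n / d : ℕ) : ℝ) / ω ≤ n / (2 * ω) := by
      rw [← div_div]
      gcongr
      exact Nat.cast_div_le.trans (by gcongr)
    gcongr
  calc (p n : ℝ) - q n ≤ ∑ d ∈ Finset.Icc 2 n, (p (n / d) : ℝ) := by
        rw [sub_le_iff_le_add']
        exact_mod_cast p_le_q_add_sum hn
    _ ≤ (n + 1 - 2 : ℕ) * Real.exp (moment logCoeff 0 ω + n / (2 * ω)) := by
        rw [← Nat.card_Icc, ← nsmul_eq_mul]
        exact Finset.sum_le_card_nsmul _ _ _ hterm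
    _ ≤ n * Real.exp (moment logCoeff 0 ω + n / (2 * ω)) := by
        gcongr
        omega

section SaddlePoint

variable {ω : ℕ → ℝ}

theorem tendsto_p_div_saddleApprox (hω : ∀ n : ℕ, 1 ≤ n → 0 < ω n ∧ moment logCoeff 1 (ω n) = n) :
    Tendsto (fun n => p n / saddleApprox logCoeff n (ω n)) atTop (𝓝 1) :=
  isAdmissible_logCoeff.tendsto_expCoeff_div_saddleApprox isExpCoeff_p hω

theorem tendsto_p_sub_q_div_saddleApprox
    (hω : ∀ n : ℕ, 1 ≤ n → 0 < ω n ∧ moment logCoeff 1 (ω n) = n) :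
    Tendsto (fun n => ((p n : ℝ) - q n) / saddleApprox logCoeff n (ω n)) atTop (𝓝 0) := by
  have hge := (isAdmissible_logCoeff.tendsto_saddlePoint hω).eventually_ge_atTop 1
  refine squeeze_zero' ?_ ?_ (isAdmissible_logCoeff.tendsto_mul_exp_half_div_saddleApprox hω)
  · filter_upwards [hge] with n hωn
    exact div_nonneg (sub_nonneg.2 (Nat.cast_le.2 (q_le_p n)))
      (isAdmissible_logCoeff.saddleApprox_pos n hωn).le
  · filter_upwards [eventually_ge_atTop 1, hge] with n hn hωn
    exact div_le_div_of_nonneg_right (p_sub_q_le (by omega) (hω n hn).1)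
      (isAdmissible_logCoeff.saddleApprox_pos n hωn).le

theorem tendsto_q_div_saddleApprox (hω : ∀ n : ℕ, 1 ≤ n → 0 < ω n ∧ moment logCoeff 1 (ω n) = n) :
    Tendsto (fun n => q n / saddleApprox logCoeff n (ω n)) atTop (𝓝 1) := by
  have hsub := (tendsto_p_div_saddleApprox hω).sub (tendsto_p_sub_q_div_saddleApprox hω)
  rw [sub_zero] at hsub
  refine hsub.congr fun n => ?_
  rw [← sub_div, sub_sub_cancel]

end SaddlePoint

theorem tendsto_q_div_p : Tendsto (fun n : ℕ => (q n : ℝ) / (p n : ℝ)) atTop (𝓝 1) := by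
  choose! ω hω _ using fun (n : ℕ) (hn : 1 ≤ n) =>
    isAdmissible_logCoeff.existsUnique_moment_eq 1 (y := n) (by positivity)
  have hratio := (tendsto_q_div_saddleApprox hω).div (tendsto_p_div_saddleApprox hω) one_ne_zero
  rw [div_one] at hratio
  refine hratio.congr' ?_
  filter_upwards [(isAdmissible_logCoeff.tendsto_saddlePoint hω).eventually_ge_atTop 1] with n hωn
  exact div_div_div_cancel_right₀ (isAdmissible_logCoeff.saddleApprox_pos n hωn).ne' _ _

end QuasiIdempotent

theorem mainTheorem8 :
    -- the series `S_m(ω)` converge absolutely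
    (∀ m : ℤ, -1 ≤ m → ∀ ω : ℝ, 0 < ω → Summable (QuasiIdempotent.STerm m ω)) ∧
    -- `ω(n)` is well defined
    (∀ n : ℕ, 1 ≤ n → ∃! ω : ℝ, 0 < ω ∧ QuasiIdempotent.S 0 ω = (n : ℝ)) ∧
    -- `q_n ∼ p_n`
    Filter.Tendsto (fun n : ℕ => (QuasiIdempotent.q n : ℝ) / (QuasiIdempotent.p n : ℝ))
      Filter.atTop (nhds 1) ∧
    -- the asymptotic formula for `q_n`
    (∀ ω : ℕ → ℝ, (∀ n : ℕ, 1 ≤ n → 0 < ω n ∧ QuasiIdempotent.S 0 (ω n) = (n : ℝ)) →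
      Filter.Tendsto
        (fun n : ℕ => (QuasiIdempotent.q n : ℝ) /
          (1 / Real.sqrt (2 * Real.pi * QuasiIdempotent.S 1 (ω n)) *
            Real.exp (QuasiIdempotent.S (-1) (ω n) + (n : ℝ) / ω n)))
        Filter.atTop (nhds 1)) := by
  refine ⟨fun m hm ω hω => QuasiIdempotent.summable_STerm hm hω, fun n hn => ?_,
    QuasiIdempotent.tendsto_q_div_p, fun ω hω => ?_⟩
  · simp only [QuasiIdempotent.S_eq_moment (m := 0) (j := 1) rfl]
    exact QuasiIdempotent.isAdmissible_logCoeff.existsUnique_moment_eq 1 (by positivity)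
  · simp only [QuasiIdempotent.S_eq_moment (m := -1) (j := 0) rfl,
      QuasiIdempotent.S_eq_moment (m := 0) (j := 1) rfl,
      QuasiIdempotent.S_eq_moment (m := 1) (j := 2) rfl] at hω ⊢
    exact QuasiIdempotent.tendsto_q_div_saddleApprox hω
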